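/- Let $X$ be a compact (Hausdorff) complex manifold of dimension $n$ with a smooth Hermitian metric $g$, i.e. a smooth Riemannian metric invariant under the complex structure $J$. Let $\omega(v,w)=g(Jv,w)$ be its fundamental form and $d$ its geodesic distance (the infimum of lengths of $C^1$ paths, equal to $+\infty$ for points in different components). Let $l>0$ and let $\kappa:[0,l]\to[0,\infty)$ be a modulus of continuity: continuous, nondecreasing, subadditive ($\kappa(s+t)\le\kappa(s)+\kappa(t)$ when $s,t\ge 0$, $s+t\le l$), $\kappa(0)=0$ and $\kappa(t)>0$ for $t>0$. Assume that there is $A>0$ with $$\limsup_{t\to0^+}\frac{4n\,\kappa(At)}{A\,\kappa(t)}<1 .$$ Let $\rho\ge 0$ be a bounded radial Borel function on $\mathbb C^n$, supported in the closed unit ball, with $\int\rho\,d\lambda=1$. For a biholomorphism $F:U\to\Omega$ from an open set $U\subset X$ onto a bounded domain $\Omega\subset\mathbb C^n$, put $\Omega_\delta=\{z\in\Omega:\operatorname{dist}(z,\partial\Omega)>\delta\}$, $U_\delta=F^{-1}(\Omega_\delta)$ and $$\mathcal R_\delta\varphi(x)=\int_{\mathbb B}\varphi\bigl(F^{-1}(F(x)+\delta\xi)\bigr)\rho(\xi)\,d\lambda(\xi),\qquad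 x\in U_\delta,$$ where $\mathbb B$ is the unit ball and $\lambda$ is Lebesgue measure. Let $\varphi:X\to\mathbb R$ be bounded and $\omega$-plurisubharmonic, that is, locally the sum of a plurisubharmonic and a smooth function, with $\omega+dd^c\varphi\ge0$ in the sense of currents, where $dd^c=2i\partial\bar\partial$. Assume that for every $x_0\in X$ there are such a chart $F:U\to\Omega$ with $x_0\in U$, $F(x_0)=0$, and constants $C_1>0$, $0<\delta_1\le l$ such that $$\mathcal R_\delta\varphi(x)-\varphi(x)\le C_1\,\kappa(\delta)\qquad\text{for all }0<\delta<\delta_1\text{ and }x\in U_\delta .$$ Then there is a constant $C_2>0$ such that $$|\varphi(x)-\varphi(y)|\le C_2\,\kappa\bigl(\min\{d(x,y),l\}\bigr)\qquad\text{for all }x,y\in X .$$ -/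

import Mathlib

open Set Filter Topology MeasureTheory Manifold Bundle
open scoped ContDiff

/-- The model space `ℂⁿ` with its Euclidean norm and Lebesgue measure. -/
abbrev Cn (n : ℕ) : Type := EuclideanSpace ℂ (Fin n)

/-- A complex manifold is in particular a smooth real manifold, for the same charts. -/
instance instRealManifoldOfComplex {n : ℕ} {X : Type*} [TopologicalSpace X] [ChartedSpace (Cn n) X]
    [IsManifold 𝓘(ℂ, Cn n) ω X] : IsManifold 𝓘(ℝ, Cn n) ∞ X := by
  apply isManifold_of_contDiffOn
  intro e e' he he'
  have h : e.symm.trans e' ∈ contDiffGroupoid ω 𝓘(ℂ, Cn n) := HasGroupoid.compatible he he'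
  have h1 := (contDiffGroupoid ω 𝓘(ℂ, Cn n)).mem_iff_of_eqOnSource (Setoid.refl _) |>.1 h
  rw [contDiffGroupoid, mem_groupoid_of_pregroupoid] at h1
  exact (ContDiffOn.restrict_scalars ℝ h1.1).of_le le_top

/-! ### Moduli of continuity -/

/-- `κ` is a modulus of continuity on `[0, l]`: continuous, nondecreasing, subadditive, vanishing at
`0` and positive elsewhere. Only the values of `κ` on `[0, l]` matter. -/
structure IsModulusOfContinuity (l : ℝ) (κ : ℝ → ℝ) : Prop where
  length_pos : 0 < l
  continuousOn : ContinuousOn κ (Icc 0 l)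
  monotoneOn : MonotoneOn κ (Icc 0 l)
  subadditive : ∀ s t : ℝ, 0 ≤ s → 0 ≤ t → s + t ≤ l → κ (s + t) ≤ κ s + κ t
  map_zero : κ 0 = 0
  pos : ∀ t ∈ Ioc 0 l, 0 < κ t

/-- The growth condition `limsup_{t → 0⁺} 4 n κ(A t) / (A κ(t)) < 1` for some `A > 0`. For a modulus
of continuity the quotient is nonnegative and, by subadditivity, bounded near `0`, so that the
real-valued `limsup` is the genuine one. -/
def GrowthCondition (n : ℕ) (κ : ℝ → ℝ) : Prop :=
  ∃ A : ℝ, 0 < A ∧ limsup (fun t : ℝ => 4 * n * κ (A * t) / (A * κ t)) (𝓝[>] 0) < 1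

/-! ### Radial kernels and local regularization -/

/-- A nonnegative bounded radial Borel kernel on `ℂⁿ`, supported in the closed unit ball, of
integral `1`. -/
structure IsRadialKernel {n : ℕ} (ρ : Cn n → ℝ) : Prop where
  measurable : Measurable ρ
  nonneg : ∀ ξ, 0 ≤ ρ ξ
  bounded : ∃ M : ℝ, ∀ ξ, ρ ξ ≤ M
  radial : ∀ ξ η, ‖ξ‖ = ‖η‖ → ρ ξ = ρ η
  support : ∀ ξ, 1 < ‖ξ‖ → ρ ξ = 0
  integral_eq_one : ∫ ξ, ρ ξ = 1

/-- `Ω_δ = {z ∈ Ω : dist(z, ∂Ω) > δ}`. -/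
def shrink {n : ℕ} (Ω : Set (Cn n)) (δ : ℝ) : Set (Cn n) :=
  {z ∈ Ω | δ < Metric.infDist z (frontier Ω)}

/-- The regularization `(u ⋆ ρ_δ)(z) = ∫_𝔹 u(z + δ ξ) ρ(ξ) dλ(ξ)`. -/
noncomputable def regularize {n : ℕ} (ρ : Cn n → ℝ) (δ : ℝ) (u : Cn n → ℝ) (z : Cn n) : ℝ :=
  ∫ ξ in Metric.ball (0 : Cn n) 1, u (z + δ • ξ) * ρ ξ

section Manifold

variable {n : ℕ} {X : Type*} [TopologicalSpace X] [ChartedSpace (Cn n) X]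

/-- The regularization `R_δ φ = (φ ∘ F⁻¹)_δ ∘ F` of `φ` in the chart `F`; it is meaningful at the
points of `F⁻¹(Ω_δ)`, where `Ω` is the image of `F`. -/
noncomputable def localRegularization (ρ : Cn n → ℝ) (F : OpenPartialHomeomorph X (Cn n)) (δ : ℝ)
    (φ : X → ℝ) (x : X) : ℝ :=
  regularize ρ δ (fun z => φ (F.symm z)) (F x)

/-- `F` is a biholomorphism from an open neighbourhood of `x₀` onto a bounded domain of `ℂⁿ`,
mapping `x₀` to `0`. -/
structure IsCenteredChart (F : OpenPartialHomeomorph X (Cn n)) (x₀ : X) : Prop where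
  holomorphic : F ∈ IsManifold.maximalAtlas 𝓘(ℂ, Cn n) ω X
  mem_source : x₀ ∈ F.source
  map_center : F x₀ = 0
  bounded : Bornology.IsBounded F.target
  connected : IsConnected F.target

/-- Around every point there is a holomorphic chart centered there in which
`R_δ φ - φ ≤ C₁ κ(δ)` on `U_δ = F⁻¹(Ω_δ)` for all small `δ > 0`. -/
def LocalRegularizationBound (l : ℝ) (κ : ℝ → ℝ) (ρ : Cn n → ℝ) (φ : X → ℝ) : Prop :=
  ∀ x₀ : X, ∃ F : OpenPartialHomeomorph X (Cn n), IsCenteredChart F x₀ ∧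
    ∃ C₁ δ₁ : ℝ, 0 < C₁ ∧ 0 < δ₁ ∧ δ₁ ≤ l ∧
      ∀ δ : ℝ, 0 < δ → δ < δ₁ → ∀ x ∈ F.source, F x ∈ shrink F.target δ →
        localRegularization ρ F δ φ x - φ x ≤ C₁ * κ δ

/-! ### Hermitian metrics -/

/-- The complex structure `J` (multiplication by `i`) on the real tangent space at `x`. Mathlib
identifies that space with `ℂⁿ` through a holomorphic chart, so that `J` is the intrinsic one. -/
noncomputable def tangentJ {x : X} (v : TangentSpace 𝓘(ℝ, Cn n) x) : TangentSpace 𝓘(ℝ, Cn n) x :=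
  (Complex.I • (show Cn n from v) : Cn n)

variable (n X) in
/-- A Hermitian metric on a complex manifold: a smooth Riemannian metric `g` for which `J` is
isometric. It corresponds to the positive `(1,1)`-form `ω(v, w) = g(J v, w)`. -/
structure HermitianMetric [IsManifold 𝓘(ℂ, Cn n) ω X] extends
    ContMDiffRiemannianMetric 𝓘(ℝ, Cn n) ∞ (Cn n) (fun x : X => TangentSpace 𝓘(ℝ, Cn n) x) where
  inner_J : ∀ (x : X) (v w : TangentSpace 𝓘(ℝ, Cn n) x),
    inner x (tangentJ v) (tangentJ w) = inner x v w

/-- The geodesic distance: the infimum of the lengths of `C¹` paths, as an extended number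
(it is infinite exactly for points in different components). -/
noncomputable def HermitianMetric.geodesicEDist [IsManifold 𝓘(ℂ, Cn n) ω X]
    (g : HermitianMetric n X) (x y : X) : ENNReal :=
  letI : RiemannianBundle (fun x : X => TangentSpace 𝓘(ℝ, Cn n) x) :=
    ⟨g.toContMDiffRiemannianMetric.toRiemannianMetric⟩
  riemannianEDist 𝓘(ℝ, Cn n) x y

/-- `g(ξ, ξ)` in the chart `F` at the point `z`, that is, `ω(ξ, J ξ)` for the form `ω` of `g`. -/
noncomputable def HermitianMetric.inChart [IsManifold 𝓘(ℂ, Cn n) ω X]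
    (g : HermitianMetric n X) (F : OpenPartialHomeomorph X (Cn n)) (z ξ : Cn n) : ℝ :=
  g.inner (F.symm z) (mfderiv 𝓘(ℝ, Cn n) 𝓘(ℝ, Cn n) F.symm z ξ)
    (mfderiv 𝓘(ℝ, Cn n) 𝓘(ℝ, Cn n) F.symm z ξ)

end Manifold

/-! ### Plurisubharmonic and `ω`-plurisubharmonic functions -/

/-- A finite-valued plurisubharmonic function on the open set `Ω`: upper semicontinuous, with the
sub-mean value property on every closed complex disc contained in `Ω`. -/
def PlurisubharmonicOn {n : ℕ} (u : Cn n → ℝ) (Ω : Set (Cn n)) : Prop :=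
  UpperSemicontinuousOn u Ω ∧
    ∀ z ξ : Cn n, (∀ ζ : ℂ, ‖ζ‖ ≤ 1 → z + ζ • ξ ∈ Ω) →
      CircleIntegrable (fun ζ : ℂ => u (z + ζ • ξ)) 0 1 ∧
        u z ≤ Real.circleAverage (fun ζ : ℂ => u (z + ζ • ξ)) 0 1

/-- The Laplacian of `χ` along the complex line spanned by `ξ`:
`D²χ(ξ, ξ) + D²χ(iξ, iξ) = 4 ∑ ∂²χ/∂z_j∂z̄_k ξ_j ξ̄_k = (dd^c χ)(ξ, J ξ)`, where `dd^c = 2 i ∂∂̄`. -/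
noncomputable def lineLaplacian {n : ℕ} (χ : Cn n → ℝ) (ξ z : Cn n) : ℝ :=
  iteratedFDeriv ℝ 2 χ z ![ξ, ξ] +
    iteratedFDeriv ℝ 2 χ z ![Complex.I • ξ, Complex.I • ξ]

section Manifold

variable {n : ℕ} {X : Type*} [TopologicalSpace X] [ChartedSpace (Cn n) X]

/-- A finite-valued quasi-plurisubharmonic function: locally, in holomorphic charts, the difference
of a plurisubharmonic and a smooth function. -/
def QuasiPlurisubharmonic (φ : X → ℝ) : Prop :=
  ∀ x₀ : X, ∃ F ∈ IsManifold.maximalAtlas 𝓘(ℂ, Cn n) ω X, x₀ ∈ F.source ∧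
    ∃ w : Cn n → ℝ, ContDiffOn ℝ ∞ w F.target ∧
      PlurisubharmonicOn (fun z => φ (F.symm z) + w z) F.target

/-- `φ` is `ω`-plurisubharmonic for the form `ω` of `g`: it is quasi-plurisubharmonic and
`ω + dd^c φ ≥ 0` in the sense of currents. The latter means that, in every holomorphic chart and for
every constant vector `ξ`, the distribution `ω(ξ, Jξ) + (dd^c φ)(ξ, Jξ)` is nonnegative on
nonnegative test functions. -/
def HermitianMetric.IsPlurisubharmonic [IsManifold 𝓘(ℂ, Cn n) ω X]
    (g : HermitianMetric n X) (φ : X → ℝ) : Prop :=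
  QuasiPlurisubharmonic (n := n) φ ∧
    ∀ F ∈ IsManifold.maximalAtlas 𝓘(ℂ, Cn n) ω X, ∀ (ξ : Cn n) (χ : Cn n → ℝ),
      ContDiff ℝ ∞ χ → HasCompactSupport χ → tsupport χ ⊆ F.target → (∀ z, 0 ≤ χ z) →
        0 ≤ ∫ z, (g.inChart F z ξ * χ z + φ (F.symm z) * lineLaplacian χ ξ z)

end Manifold

/-! Read `φ` in a chart, as a bounded function `u` on a ball of `ℂⁿ`. There the metric is bounded,
so the Laplacian of `u` along every complex line is at least `-C‖ξ‖²` in the sense of distributions.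
Hence `u` satisfies a sub-mean value inequality with error `C δ²` against every circular kernel at
scale `δ` (`submean_kernel`). It is proved on circles for mollifications of `u` and passes to the
limit almost everywhere. It then holds everywhere, because kernel averages are continuous and
plurisubharmonicity makes `u x` nearly attained off null sets arbitrarily close to `x`.

The hypothesis bounds averages against `ρ` from above, but `ρ` may vanish near the origin.
Regularizing twice replaces it by `σ = ρ ⋆ ρ`, which is at least some `c > 0` on a ball of radius
`r`. The kernel `σ - c 1_{B(0, r)}` is still nonnegative and circular. Subtracting its sub-mean
inequality from the upper bound for `σ` shows that the mean of `u` over `B(x, s)` is at most `u x +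
C₂ κ(s)` (`exists_ball_mean_le`).

The oscillation is then improved from scale `s = A w` to scale `w`. Suppose `u ≥ u x - D κ(s)` on
`B(x, s)` and `‖y - x‖ ≤ w`. The nonnegative function `u - u x + D κ(s)` has a smaller integral over
`B(y, s - w)` than over `B(x, s)`. Bounding the first integral below by the sub-mean inequality at
`y`, and the second above by the ball mean at `x`, gives `u y - u x` at most a multiple of `κ(s)`
independent of `D`, plus `((A/(A-1))^{2n} - 1) D κ(s)`. The last factor is at most `4n/A`, and the
growth condition says exactly that `(4n/A) κ(A w) ≤ q κ(w)` with `q < 1`. So the bound `D κ`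
reproduces itself once `D` is large (`oscillation_step`, `exists_local_modulus`).

Charts are locally Lipschitz for the geodesic distance, subadditivity of `κ` absorbs the Lipschitz
constant, boundedness of `φ` handles distant points, and compactness of `X` makes the constant
uniform. -/

/-! ### Sub-mean value inequalities on circles for smooth functions -/

/-- Differentiation under an interval integral with a jointly continuous derivative. -/
theorem hasDerivAt_intervalIntegral_of_continuous {G G' : ℝ → ℝ → ℝ} {a b : ℝ}
    (hG : ∀ r, Continuous (G r)) (hG' : Continuous (Function.uncurry G'))
    (hd : ∀ r θ, HasDerivAt (fun s => G s θ) (G' r θ) r) (r : ℝ) :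
    HasDerivAt (fun s => ∫ θ in a..b, G s θ) (∫ θ in a..b, G' r θ) r := by
  obtain ⟨B, hB⟩ := ((isCompact_Icc (a := r - 1) (b := r + 1)).prod
    (isCompact_uIcc (a := a) (b := b))).exists_bound_of_continuousOn hG'.continuousOn
  refine (intervalIntegral.hasDerivAt_integral_of_dominated_loc_of_deriv_le
    (F := G) (F' := G') (x₀ := r) (s := Icc (r - 1) (r + 1)) (bound := fun _ => B)
    (Icc_mem_nhds (by linarith) (by linarith)) ?_ ?_ ?_ ?_ ?_ ?_).2
  · exact Eventually.of_forall fun s => (hG s).aestronglyMeasurable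
  · exact (hG r).intervalIntegrable _ _
  · exact (hG'.comp (Continuous.prodMk_right r)).aestronglyMeasurable
  · exact Eventually.of_forall fun θ hθ s hs => hB (s, θ) ⟨hs, uIoc_subset_uIcc hθ⟩
  · exact intervalIntegrable_const
  · exact Eventually.of_forall fun θ _ s _ => hd s θ

theorem lineLaplacian_eq_fderiv {n : ℕ} (χ : Cn n → ℝ) (ξ z : Cn n) :
    lineLaplacian χ ξ z = fderiv ℝ (fderiv ℝ χ) z ξ ξ
      + fderiv ℝ (fderiv ℝ χ) z (Complex.I • ξ) (Complex.I • ξ) := by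
  simp [lineLaplacian, iteratedFDeriv_two_apply]

/-- The point `exp (iθ) ξ`. -/
noncomputable def circlePoint {n : ℕ} (ξ : Cn n) (θ : ℝ) : Cn n := circleMap 0 1 θ • ξ

theorem continuous_circlePoint {n : ℕ} : Continuous (Function.uncurry (circlePoint (n := n))) := by
  unfold circlePoint Function.uncurry
  fun_prop

theorem norm_circlePoint {n : ℕ} (ξ : Cn n) (θ : ℝ) : ‖circlePoint ξ θ‖ = ‖ξ‖ := by
  simp [circlePoint, norm_smul]

theorem circlePoint_two_pi {n : ℕ} (ξ : Cn n) :
    circlePoint ξ (2 * Real.pi) = circlePoint ξ 0 := by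
  have := periodic_circleMap 0 1 0
  simp only [zero_add] at this
  simp [circlePoint, this]

theorem hasDerivAt_circlePoint {n : ℕ} (ξ : Cn n) (θ : ℝ) :
    HasDerivAt (circlePoint ξ) (Complex.I • circlePoint ξ θ) θ := by
  have h : HasDerivAt (circlePoint ξ) ((circleMap 0 1 θ * Complex.I) • ξ) θ :=
    (hasDerivAt_circleMap 0 1 θ).smul_const ξ
  refine h.congr_deriv ?_
  rw [circlePoint, smul_smul, mul_comm]

/-- The sub-mean value inequality on an ellipse `e` with conjugate parametrization `f`, for a smooth
function whose Laplacian along the plane of the ellipse is bounded below. -/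
theorem ellipse_submean_of_laplacian {E : Type*} [NormedAddCommGroup E] [NormedSpace ℝ E]
    {v : E → ℝ} (hv : ContDiff ℝ ∞ v) (x : E) {e f : ℝ → E}
    (he : ∀ θ, HasDerivAt e (f θ) θ) (hf : ∀ θ, HasDerivAt f (-e θ) θ)
    (he0 : e (2 * Real.pi) = e 0) (hf0 : f (2 * Real.pi) = f 0) {C : ℝ}
    (hC : ∀ r ∈ Icc (0 : ℝ) 1, ∀ θ : ℝ,
      -C ≤ fderiv ℝ (fderiv ℝ v) (x + r • e θ) (e θ) (e θ)
        + fderiv ℝ (fderiv ℝ v) (x + r • e θ) (f θ) (f θ)) :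
    2 * Real.pi * (v x - C / 4) ≤ ∫ θ in (0 : ℝ)..2 * Real.pi, v (x + e θ) := by
  have hec : Continuous e := continuous_iff_continuousAt.2 fun θ => (he θ).continuousAt
  have hfc : Continuous f := continuous_iff_continuousAt.2 fun θ => (hf θ).continuousAt
  have hv1 : ContDiff ℝ ∞ (fderiv ℝ v) := hv.fderiv_right (by simp)
  have hv2 : ContDiff ℝ ∞ (fderiv ℝ (fderiv ℝ v)) := hv1.fderiv_right (by simp)
  have hvc := hv.continuous
  have hv1c := hv1.continuous
  have hv2c := hv2.continuous
  have hp : ∀ r θ, HasDerivAt (fun s : ℝ => x + s • e θ) (e θ) r := fun r θ => by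
    simpa using ((hasDerivAt_id r).smul_const (e θ)).const_add x
  have hpθ : ∀ r θ, HasDerivAt (fun t : ℝ => x + r • e t) (r • f θ) θ := fun r θ => by
    exact HasDerivAt.const_add x (HasDerivAt.const_smul (R := ℝ) r (he θ))
  have hvd : ∀ z, HasFDerivAt v (fderiv ℝ v z) z := fun z =>
    (hv.differentiable (by simp) z).hasFDerivAt
  have hvd2 : ∀ z, HasFDerivAt (fderiv ℝ v) (fderiv ℝ (fderiv ℝ v) z) z := fun z =>
    (hv1.differentiable (by simp) z).hasFDerivAt
  -- first derivative in `r`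
  set D1 : ℝ → ℝ → ℝ := fun r θ => fderiv ℝ v (x + r • e θ) (e θ)
  set D2 : ℝ → ℝ → ℝ := fun r θ => fderiv ℝ (fderiv ℝ v) (x + r • e θ) (e θ) (e θ)
  have hD1c : Continuous (Function.uncurry D1) := by
    unfold D1 Function.uncurry
    exact (hv1c.comp (by fun_prop)).clm_apply (by fun_prop)
  have hD2c : Continuous (Function.uncurry D2) := by
    unfold D2 Function.uncurry
    exact ((hv2c.comp (by fun_prop)).clm_apply (by fun_prop)).clm_apply (by fun_prop)
  have ha : ∀ r, HasDerivAt (fun s => ∫ θ in (0 : ℝ)..2 * Real.pi, v (x + s • e θ))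
      (∫ θ in (0 : ℝ)..2 * Real.pi, D1 r θ) r := by
    refine hasDerivAt_intervalIntegral_of_continuous (fun r => hvc.comp (by fun_prop)) hD1c ?_
    exact fun r θ => (hvd _).comp_hasDerivAt r (hp r θ)
  have hb : ∀ r, HasDerivAt (fun s => ∫ θ in (0 : ℝ)..2 * Real.pi, D1 s θ)
      (∫ θ in (0 : ℝ)..2 * Real.pi, D2 r θ) r := by
    refine hasDerivAt_intervalIntegral_of_continuous
      (fun r => hD1c.comp (Continuous.prodMk_right r)) hD2c ?_
    intro r θ
    have h1 := (hvd2 (x + r • e θ)).comp_hasDerivAt r (hp r θ)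
    simpa using h1.clm_apply (hasDerivAt_const r (e θ))
  -- the angular derivative integrates to zero
  have hang : ∀ r, ∫ θ in (0 : ℝ)..2 * Real.pi,
      (r ^ 2 * fderiv ℝ (fderiv ℝ v) (x + r • e θ) (f θ) (f θ)
        - r * D1 r θ) = 0 := by
    intro r
    have hder : ∀ θ, HasDerivAt (fun t => fderiv ℝ v (x + r • e t) (r • f t))
        (r ^ 2 * fderiv ℝ (fderiv ℝ v) (x + r • e θ) (f θ) (f θ)
        - r * D1 r θ) θ := by
      intro θ
      have h1 := (hvd2 (x + r • e θ)).comp_hasDerivAt θ (hpθ r θ)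
      have h2 : HasDerivAt (fun t => r • f t) (r • (-e θ)) θ :=
        (hf θ).const_smul r
      have h3 := h1.clm_apply h2
      refine h3.congr_deriv ?_
      simp only [map_smul, smul_neg, map_neg, smul_apply, smul_eq_mul,
        Function.comp, D1]
      ring
    have hcont : Continuous fun θ => (r ^ 2 * fderiv ℝ (fderiv ℝ v) (x + r • e θ)
        (f θ) (f θ) - r * D1 r θ) := by
      refine Continuous.sub (continuous_const.mul ?_)
        (continuous_const.mul (hD1c.comp (Continuous.prodMk_right r)))
      exact ((hv2c.comp (by fun_prop)).clm_apply (by fun_prop)).clm_apply (by fun_prop)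
    rw [intervalIntegral.integral_eq_sub_of_hasDerivAt (fun θ _ => hder θ)
      (hcont.intervalIntegrable _ _)]
    simp [he0, hf0]
  have hpi := Real.pi_pos
  have hD1i : ∀ r, IntervalIntegrable (D1 r) volume 0 (2 * Real.pi) := fun r =>
    (hD1c.comp (Continuous.prodMk_right r)).intervalIntegrable _ _
  -- The Laplacian in polar form: adding the vanishing angular integral to `r² ∫ D2 + r ∫ D1` turns
  -- it into `r²` times the integral of the Laplacian, which is bounded below by `-C`.
  have hkey : ∀ r ∈ Icc (0 : ℝ) 1, -(2 * Real.pi * C) * r ^ 2 ≤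
      r ^ 2 * (∫ θ in (0 : ℝ)..2 * Real.pi, D2 r θ) +
        r * ∫ θ in (0 : ℝ)..2 * Real.pi, D1 r θ := by
    intro r hr
    have hc3 : Continuous fun θ => fderiv ℝ (fderiv ℝ v) (x + r • e θ)
        (f θ) (f θ) :=
      ((hv2c.comp (by fun_prop)).clm_apply (by fun_prop)).clm_apply (by fun_prop)
    have hc2 : Continuous (D2 r) := hD2c.comp (Continuous.prodMk_right r)
    have h0 := hang r
    rw [intervalIntegral.integral_sub ((hc3.const_mul _).intervalIntegrable _ _)
      ((hD1i r).const_mul _), intervalIntegral.integral_const_mul,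
      intervalIntegral.integral_const_mul] at h0
    have h1 : ∫ θ in (0 : ℝ)..2 * Real.pi, (-C : ℝ) ≤ ∫ θ in (0 : ℝ)..2 * Real.pi,
        (D2 r θ + fderiv ℝ (fderiv ℝ v) (x + r • e θ) (f θ) (f θ)) := by
      refine intervalIntegral.integral_mono (by positivity) intervalIntegrable_const
        ((hc2.add hc3).intervalIntegrable _ _) fun θ => ?_
      exact hC r hr θ
    rw [intervalIntegral.integral_add (hc2.intervalIntegrable _ _) (hc3.intervalIntegrable _ _),
      intervalIntegral.integral_const, smul_eq_mul] at h1
    have h2 := mul_le_mul_of_nonneg_left h1 (sq_nonneg r)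
    linarith
  -- `r ∫ D1` is bounded below
  set b : ℝ → ℝ := fun r => ∫ θ in (0 : ℝ)..2 * Real.pi, D1 r θ
  set a : ℝ → ℝ := fun r => ∫ θ in (0 : ℝ)..2 * Real.pi, v (x + r • e θ)
  -- By `hkey`, `r` times this derivative is nonnegative, so `b r ≥ -π C r`. A second integration
  -- makes `a r + (π C / 2) r²` increasing, and `π C / 2 = 2π · C / 4` at `r = 1` is the stated
  -- error.
  have hq : ∀ r, HasDerivAt (fun r => r * b r + Real.pi * C * r ^ 2)
      (b r + r * (∫ θ in (0 : ℝ)..2 * Real.pi, D2 r θ) + 2 * Real.pi * C * r) r := by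
    intro r
    have := ((hasDerivAt_id r).mul (hb r)).add (((hasDerivAt_pow 2 r).const_mul (Real.pi * C)))
    refine this.congr_deriv ?_
    simp [b]; ring
  have hqm : MonotoneOn (fun r => r * b r + Real.pi * C * r ^ 2) (Icc 0 1) := by
    refine monotoneOn_of_deriv_nonneg (convex_Icc 0 1)
      (fun r _ => (hq r).continuousAt.continuousWithinAt)
      (fun r _ => (hq r).differentiableAt.differentiableWithinAt) ?_
    intro r hr
    rw [interior_Icc] at hr
    rw [(hq r).deriv]
    have h := hkey r ⟨hr.1.le, hr.2.le⟩
    have : 0 ≤ r * (b r + r * (∫ θ in (0 : ℝ)..2 * Real.pi, D2 r θ) + 2 * Real.pi * C * r) := by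
      simp only [b]; linarith
    exact nonneg_of_mul_nonneg_right this hr.1
  have hA : ∀ r, HasDerivAt (fun r => a r + Real.pi * C / 2 * r ^ 2) (b r + Real.pi * C * r) r := by
    intro r
    refine ((ha r).add ((hasDerivAt_pow 2 r).const_mul (Real.pi * C / 2))).congr_deriv ?_
    simp [b]; ring
  have hAm : MonotoneOn (fun r => a r + Real.pi * C / 2 * r ^ 2) (Icc 0 1) := by
    refine monotoneOn_of_deriv_nonneg (convex_Icc 0 1)
      (fun r _ => (hA r).continuousAt.continuousWithinAt)
      (fun r _ => (hA r).differentiableAt.differentiableWithinAt) ?_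
    intro r hr
    rw [interior_Icc] at hr
    rw [(hA r).deriv]
    have h := hqm (left_mem_Icc.2 zero_le_one) ⟨hr.1.le, hr.2.le⟩ hr.1.le
    simp only [zero_mul, ne_eq, OfNat.ofNat_ne_zero, not_false_eq_true, zero_pow, mul_zero,
      add_zero] at h
    have : 0 ≤ r * (b r + Real.pi * C * r) := by linarith
    exact nonneg_of_mul_nonneg_right this hr.1
  have h := hAm (left_mem_Icc.2 zero_le_one) (right_mem_Icc.2 zero_le_one) zero_le_one
  simp only [a, zero_smul, add_zero, intervalIntegral.integral_const, smul_eq_mul, one_smul,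
    ne_eq, OfNat.ofNat_ne_zero, not_false_eq_true, zero_pow, mul_zero, one_pow, mul_one,
    sub_zero] at h
  linarith

/-- The sub-mean value inequality on a circle for a smooth function whose Laplacian along the
complex line is bounded below. -/
theorem circle_submean_of_lineLaplacian {n : ℕ} {v : Cn n → ℝ} (hv : ContDiff ℝ ∞ v)
    (x ξ : Cn n) {C : ℝ} (hC : ∀ r ∈ Icc (0 : ℝ) 1, ∀ θ : ℝ,
      -C ≤ lineLaplacian v (circlePoint ξ θ) (x + r • circlePoint ξ θ)) :
    2 * Real.pi * (v x - C / 4) ≤ ∫ θ in (0 : ℝ)..2 * Real.pi, v (x + circlePoint ξ θ) := by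
  refine ellipse_submean_of_laplacian hv x (f := fun θ => Complex.I • circlePoint ξ θ)
    (hasDerivAt_circlePoint ξ) (fun θ => ?_) (circlePoint_two_pi ξ) ?_ fun r hr θ => ?_
  · refine ((hasDerivAt_circlePoint ξ θ).const_smul Complex.I).congr_deriv ?_
    simp [smul_smul]
  · simp only [circlePoint_two_pi]
  · simpa only [lineLaplacian_eq_fderiv] using hC r hr θ

/-! ### Circular kernels -/

/-- A bounded nonnegative kernel on `ℂⁿ`, supported in the closed ball of radius `2`, that is
invariant under multiplication by complex numbers of modulus one. -/
structure IsCircularKernel {n : ℕ} (k : Cn n → ℝ) : Prop where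
  measurable : Measurable k
  nonneg : ∀ ξ, 0 ≤ k ξ
  bounded : ∃ M : ℝ, ∀ ξ, k ξ ≤ M
  circular : ∀ c : ℂ, ‖c‖ = 1 → ∀ ξ, k (c • ξ) = k ξ
  support : ∀ ξ, 2 < ‖ξ‖ → k ξ = 0

theorem integrable_of_bounded_of_support {n : ℕ} {f : Cn n → ℝ} (hf : Measurable f) {M R : ℝ}
    (hM : ∀ ξ, |f ξ| ≤ M) (hR : ∀ ξ, R < ‖ξ‖ → f ξ = 0) : Integrable f := by
  have h : IntegrableOn f (Metric.closedBall 0 R) :=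
    Measure.integrableOn_of_bounded (M := M)
      (isCompact_closedBall (0 : Cn n) R).measure_lt_top.ne
      hf.aestronglyMeasurable (Eventually.of_forall hM)
  refine (integrableOn_iff_integrable_of_support_subset fun ξ hξ => ?_).1 h
  rw [mem_closedBall_zero_iff]
  by_contra h'
  exact hξ (hR ξ (not_le.1 h'))

theorem IsCircularKernel.integrable {n : ℕ} {k : Cn n → ℝ} (hk : IsCircularKernel k) :
    Integrable k := by
  obtain ⟨M, hM⟩ := hk.bounded
  refine integrable_of_bounded_of_support hk.measurable (M := M) (R := 2) (fun ξ => ?_) hk.support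
  rw [abs_of_nonneg (hk.nonneg ξ)]
  exact hM ξ

theorem measurePreserving_unit_smul {n : ℕ} {c : ℂ} (hc : ‖c‖ = 1) :
    MeasurePreserving (fun ξ : Cn n => c • ξ) := by
  have hc0 : c ≠ 0 := by rintro rfl; simp at hc
  let e : Cn n ≃ₗᵢ[ℝ] Cn n :=
    { (LinearEquiv.smulOfNeZero ℂ (Cn n) c hc0).restrictScalars ℝ with
      norm_map' := fun ξ => by
        change ‖c • ξ‖ = ‖ξ‖
        rw [norm_smul, hc, one_mul] }
  exact e.measurePreserving

theorem integral_unit_smul {n : ℕ} {c : ℂ} (hc : ‖c‖ = 1) (f : Cn n → ℝ) :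
    ∫ ξ, f (c • ξ) = ∫ ξ, f ξ := by
  have hc0 : c ≠ 0 := by rintro rfl; simp at hc
  exact (measurePreserving_unit_smul hc).integral_comp
    (MeasurableEquiv.smul₀ c hc0).measurableEmbedding f

/-- A kernel average is a kernel average of circle averages. -/
theorem integral_mul_circular_eq {n : ℕ} {k : Cn n → ℝ} (hk : IsCircularKernel k)
    {v : Cn n → ℝ} (hv : Continuous v) {M : ℝ} (hM : ∀ ξ, |v ξ| ≤ M) :
    2 * Real.pi * ∫ ξ, v ξ * k ξ
      = ∫ ξ, (∫ θ in (0 : ℝ)..2 * Real.pi, v (circlePoint ξ θ)) * k ξ := by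
  -- Lebesgue measure and `k` are both invariant under `ξ ↦ exp (iθ) ξ`, so the integral does not
  -- depend on `θ`. It may be averaged over `θ`, and Fubini does the rest.
  have hrot : ∀ θ : ℝ, ∫ ξ, v (circlePoint ξ θ) * k ξ = ∫ ξ, v ξ * k ξ := by
    intro θ
    have hc : ‖circleMap 0 1 θ‖ = 1 := by simp
    rw [← integral_unit_smul hc (fun ξ => v ξ * k ξ)]
    refine integral_congr_ae (Eventually.of_forall fun ξ => ?_)
    simp only [circlePoint, hk.circular _ hc]
  have hint : Integrable (Function.uncurry fun (θ : ℝ) (ξ : Cn n) => v (circlePoint ξ θ) * k ξ)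
      ((volume.restrict (uIoc 0 (2 * Real.pi))).prod volume) := by
    have h1 : Integrable (fun p : ℝ × Cn n => k p.2)
        ((volume.restrict (uIoc 0 (2 * Real.pi))).prod volume) := by
      have : IsFiniteMeasure (volume.restrict (uIoc 0 (2 * Real.pi))) := by
        rw [uIoc]; infer_instance
      exact hk.integrable.comp_snd _
    refine h1.bdd_mul (c := M) ?_ (Eventually.of_forall fun p => hM _)
    exact (hv.comp (continuous_circlePoint.comp continuous_swap)).aestronglyMeasurable
  have h := intervalIntegral_integral_swap hint
  simp only [hrot, intervalIntegral.integral_const, sub_zero, smul_eq_mul] at h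
  rw [h]
  refine integral_congr_ae (Eventually.of_forall fun ξ => ?_)
  simp only [intervalIntegral.integral_mul_const]

/-- The sub-mean value inequality of a smooth function for circular kernels. -/
theorem smooth_submean_kernel {n : ℕ} {k : Cn n → ℝ} (hk : IsCircularKernel k)
    {v : Cn n → ℝ} (hv : ContDiff ℝ ∞ v) {M : ℝ} (hM : ∀ ξ, |v ξ| ≤ M)
    {C : ℝ} (hC0 : 0 ≤ C) (x : Cn n) {δ : ℝ} (hδ : 0 < δ)
    (hC : ∀ z, ‖z - x‖ ≤ 2 * δ → ∀ ξ, -(C * ‖ξ‖ ^ 2) ≤ lineLaplacian v ξ z) :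
    (∫ ξ, k ξ) * (v x - C * δ ^ 2) ≤ ∫ ξ, v (x + δ • ξ) * k ξ := by
  have hpi := Real.pi_pos
  have hw : Continuous fun ξ => v (x + δ • ξ) := hv.continuous.comp (by fun_prop)
  have h1 := integral_mul_circular_eq hk hw (fun ξ => hM (x + δ • ξ))
  have h2 : ∫ ξ, 2 * Real.pi * (v x - C * δ ^ 2) * k ξ ≤
      ∫ ξ, (∫ θ in (0 : ℝ)..2 * Real.pi, v (x + δ • circlePoint ξ θ)) * k ξ := by
    refine integral_mono (hk.integrable.const_mul _) ?_ fun ξ => ?_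
    · refine hk.integrable.bdd_mul (c := M * |2 * Real.pi - 0|) ?_
        (Eventually.of_forall fun ξ =>
          intervalIntegral.norm_integral_le_of_norm_le_const fun θ _ => hM _)
      refine Continuous.aestronglyMeasurable ?_
      refine intervalIntegral.continuous_parametric_intervalIntegral_of_continuous' ?_ _ _
      exact hv.continuous.comp (continuous_const.add (continuous_circlePoint.const_smul δ))
    · rcases lt_or_ge 2 ‖ξ‖ with h | h
      · simp [hk.support ξ h]
      refine mul_le_mul_of_nonneg_right ?_ (hk.nonneg ξ)
      -- On the support of `k` the circle has radius at most `2δ`. The square of this gives the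
      -- factor `4`, which cancels the `1/4` of the circle inequality.
      have h3 := circle_submean_of_lineLaplacian hv x (δ • ξ) (C := 4 * C * δ ^ 2) ?_
      · have h4 : ∀ θ, circlePoint (δ • ξ) θ = δ • circlePoint ξ θ := fun θ => by
          simp only [circlePoint]; rw [smul_comm]
        simp only [h4] at h3
        linarith
      · intro r hr θ
        have hn : ‖circlePoint (δ • ξ) θ‖ ≤ 2 * δ := by
          rw [norm_circlePoint, norm_smul, Real.norm_of_nonneg hδ.le]
          nlinarith
        refine le_trans ?_ (hC _ ?_ _)
        · have : ‖circlePoint (δ • ξ) θ‖ ^ 2 ≤ (2 * δ) ^ 2 :=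
            pow_le_pow_left₀ (norm_nonneg _) hn 2
          nlinarith
        · rw [add_sub_cancel_left, norm_smul, Real.norm_of_nonneg hr.1]
          calc _ ≤ 1 * ‖circlePoint (δ • ξ) θ‖ :=
                mul_le_mul_of_nonneg_right hr.2 (norm_nonneg _)
            _ ≤ _ := by linarith
  rw [integral_const_mul, ← h1] at h2
  have h5 : 2 * Real.pi * ((∫ ξ, k ξ) * (v x - C * δ ^ 2)) ≤
      2 * Real.pi * ∫ ξ, v (x + δ • ξ) * k ξ := by linarith
  exact le_of_mul_le_mul_left h5 (by positivity)

/-! ### Mollification -/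

open scoped Convolution

/-- The mollification of `u` by `η`. -/
noncomputable def mollify {n : ℕ} (u η : Cn n → ℝ) : Cn n → ℝ :=
  u ⋆[ContinuousLinearMap.mul ℝ ℝ, volume] η

theorem mollify_apply {n : ℕ} (u η : Cn n → ℝ) (x : Cn n) :
    mollify u η x = ∫ t, u t * η (x - t) := rfl

/-- The order of factors in which convergence at Lebesgue points is available for normalized bumps.
-/
theorem mollify_eq_normed_convolution {n : ℕ} (u η : Cn n → ℝ) (x : Cn n) :
    mollify u η x = (η ⋆[ContinuousLinearMap.lsmul ℝ ℝ, volume] u) x := by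
  rw [convolution_lsmul_swap, mollify_apply]
  simp only [smul_eq_mul, mul_comm]

theorem contDiff_mollify {n : ℕ} {u η : Cn n → ℝ} (hu : LocallyIntegrable u)
    (hη : ContDiff ℝ ∞ η) (hc : HasCompactSupport η) : ContDiff ℝ ∞ (mollify u η) :=
  hc.contDiff_convolution_right (n := ⊤) _ hu hη

theorem fderiv_mollify_apply {n : ℕ} {u η : Cn n → ℝ} (hu : LocallyIntegrable u)
    (hη : ContDiff ℝ ∞ η) (hc : HasCompactSupport η) (x ξ : Cn n) :
    fderiv ℝ (mollify u η) x ξ = mollify u (fun z => fderiv ℝ η z ξ) x := by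
  have h := hc.hasFDerivAt_convolution_right (ContinuousLinearMap.mul ℝ ℝ) hu
    (hη.of_le (by simp)) x
  rw [mollify, h.fderiv]
  exact convolution_precompR_apply _ hu (hc.fderiv ℝ)
    (hη.continuous_fderiv (by simp)) x ξ

theorem fderiv_fderiv_apply {n : ℕ} {η : Cn n → ℝ} (hη : ContDiff ℝ ∞ η) (x ξ : Cn n) :
    fderiv ℝ (fderiv ℝ η) x ξ ξ = fderiv ℝ (fun z => fderiv ℝ η z ξ) x ξ := by
  have h1 : ContDiff ℝ ∞ (fderiv ℝ η) := hη.fderiv_right (by simp)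
  have h := (h1.differentiable (by simp) x).hasFDerivAt.clm_apply (hasFDerivAt_const ξ x)
  rw [h.fderiv]
  simp

theorem fderiv_fderiv_mollify_apply {n : ℕ} {u η : Cn n → ℝ} (hu : LocallyIntegrable u)
    (hη : ContDiff ℝ ∞ η) (hc : HasCompactSupport η) (x ξ : Cn n) :
    fderiv ℝ (fderiv ℝ (mollify u η)) x ξ ξ
      = mollify u (fun z => fderiv ℝ (fderiv ℝ η) z ξ ξ) x := by
  rw [fderiv_fderiv_apply (contDiff_mollify hu hη hc)]
  have h : (fun z => fderiv ℝ (mollify u η) z ξ) = mollify u (fun z => fderiv ℝ η z ξ) :=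
    funext fun z => fderiv_mollify_apply hu hη hc z ξ
  rw [h, fderiv_mollify_apply hu ((hη.fderiv_right (by simp)).clm_apply contDiff_const)
    ((hc.fderiv ℝ).comp_left (g := fun L : Cn n →L[ℝ] ℝ => L ξ) (by simp))]
  congr 1
  exact funext fun z => (fderiv_fderiv_apply hη z ξ).symm

theorem fderiv_const_sub_comp {n : ℕ} {F : Type*} [NormedAddCommGroup F] [NormedSpace ℝ F]
    {f : Cn n → F} (hf : Differentiable ℝ f) (x : Cn n) :
    fderiv ℝ (fun s => f (x - s)) = fun s => -fderiv ℝ f (x - s) := by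
  funext s
  have h := (hf (x - s)).hasFDerivAt.comp s ((hasFDerivAt_id s).const_sub x)
  refine h.fderiv.trans ?_
  ext w
  simp

theorem lineLaplacian_const_sub_comp {n : ℕ} {η : Cn n → ℝ} (hη : ContDiff ℝ ∞ η)
    (x ξ t : Cn n) :
    lineLaplacian (fun s => η (x - s)) ξ t = lineLaplacian η ξ (x - t) := by
  have h1 : ContDiff ℝ ∞ (fderiv ℝ η) := hη.fderiv_right (by simp)
  have h2 : fderiv ℝ (fderiv ℝ fun s => η (x - s)) t = fderiv ℝ (fderiv ℝ η) (x - t) := by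
    rw [fderiv_const_sub_comp (hη.differentiable (by simp)), fderiv_fun_neg,
      fderiv_const_sub_comp (h1.differentiable (by simp)), neg_neg]
  rw [lineLaplacian_eq_fderiv, lineLaplacian_eq_fderiv, h2]

/-- All derivatives fall on `η`, so the Laplacian of the mollification at `x` is the distributional
Laplacian of `u` tested on `s ↦ η (x - s)`. -/
theorem lineLaplacian_mollify {n : ℕ} {u η : Cn n → ℝ} (hu : LocallyIntegrable u)
    (hη : ContDiff ℝ ∞ η) (hc : HasCompactSupport η) (x ξ : Cn n) :
    lineLaplacian (mollify u η) ξ x = ∫ t, u t * lineLaplacian (fun s => η (x - s)) ξ t := by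
  have h1 : ContDiff ℝ ∞ (fderiv ℝ η) := hη.fderiv_right (by simp)
  have h2 : ContDiff ℝ ∞ (fderiv ℝ (fderiv ℝ η)) := h1.fderiv_right (by simp)
  have hint : ∀ ζ : Cn n, Integrable fun t => u t * fderiv ℝ (fderiv ℝ η) (x - t) ζ ζ := by
    intro ζ
    have hcs : HasCompactSupport fun z => fderiv ℝ (fderiv ℝ η) z ζ ζ :=
      ((hc.fderiv ℝ).fderiv ℝ).comp_left
        (g := fun L : Cn n →L[ℝ] Cn n →L[ℝ] ℝ => L ζ ζ) (by simp)
    exact hcs.convolutionExists_right (ContinuousLinearMap.mul ℝ ℝ) hu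
      ((h2.continuous.clm_apply continuous_const).clm_apply continuous_const) x
  simp only [lineLaplacian_const_sub_comp hη]
  simp only [lineLaplacian_eq_fderiv, fderiv_fderiv_mollify_apply hu hη hc, mollify_apply,
    mul_add]
  rw [integral_add (hint ξ) (hint (Complex.I • ξ))]

/-- `dd^c u ≥ -C` in the sense of distributions, tested on the ball of radius `R`. -/
def DistribLineLaplacianGe {n : ℕ} (u : Cn n → ℝ) (R C : ℝ) : Prop :=
  ∀ (ξ : Cn n) (χ : Cn n → ℝ), ContDiff ℝ ∞ χ → HasCompactSupport χ →
    tsupport χ ⊆ Metric.ball 0 R → (∀ z, 0 ≤ χ z) →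
      0 ≤ ∫ z, (C * ‖ξ‖ ^ 2 * χ z + u z * lineLaplacian χ ξ z)

theorem continuous_lineLaplacian {n : ℕ} {χ : Cn n → ℝ} (hχ : ContDiff ℝ ∞ χ) (ξ : Cn n) :
    Continuous (lineLaplacian χ ξ) := by
  have h1 : ContDiff ℝ ∞ (fderiv ℝ χ) := hχ.fderiv_right (by simp)
  have h2 : ContDiff ℝ ∞ (fderiv ℝ (fderiv ℝ χ)) := h1.fderiv_right (by simp)
  have : lineLaplacian χ ξ = fun z => fderiv ℝ (fderiv ℝ χ) z ξ ξ
      + fderiv ℝ (fderiv ℝ χ) z (Complex.I • ξ) (Complex.I • ξ) :=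
    funext fun z => lineLaplacian_eq_fderiv χ ξ z
  rw [this]
  exact ((h2.continuous.clm_apply continuous_const).clm_apply continuous_const).add
    ((h2.continuous.clm_apply continuous_const).clm_apply continuous_const)

theorem hasCompactSupport_lineLaplacian {n : ℕ} {χ : Cn n → ℝ} (hc : HasCompactSupport χ)
    (ξ : Cn n) : HasCompactSupport (lineLaplacian χ ξ) := by
  have : lineLaplacian χ ξ = fun z => fderiv ℝ (fderiv ℝ χ) z ξ ξ
      + fderiv ℝ (fderiv ℝ χ) z (Complex.I • ξ) (Complex.I • ξ) :=
    funext fun z => lineLaplacian_eq_fderiv χ ξ z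
  rw [this]
  exact ((hc.fderiv ℝ).fderiv ℝ).comp_left (g := fun L : Cn n →L[ℝ] Cn n →L[ℝ] ℝ =>
    L ξ ξ + L (Complex.I • ξ) (Complex.I • ξ)) (by simp)

theorem integrable_mul_lineLaplacian {n : ℕ} {u χ : Cn n → ℝ} (hu : LocallyIntegrable u)
    (hχ : ContDiff ℝ ∞ χ) (hc : HasCompactSupport χ) (ξ : Cn n) :
    Integrable fun z => u z * lineLaplacian χ ξ z := by
  simpa only [smul_eq_mul, mul_comm] using hu.integrable_smul_left_of_hasCompactSupport
    (continuous_lineLaplacian hχ ξ) (hasCompactSupport_lineLaplacian hc ξ)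

/-- The distributional inequality is applied to `s ↦ η (x - s)`, which is nonnegative, has integral
`1` and is supported within `b.rOut` of `x`. A lower bound in the sense of distributions thus
becomes a pointwise one. -/
theorem lineLaplacian_mollify_ge {n : ℕ} {u : Cn n → ℝ} (hu : LocallyIntegrable u) {R C : ℝ}
    (hD : DistribLineLaplacianGe u R C) (b : ContDiffBump (0 : Cn n)) {x : Cn n}
    (hx : ‖x‖ + b.rOut < R) (ξ : Cn n) :
    -(C * ‖ξ‖ ^ 2) ≤ lineLaplacian (mollify u (b.normed volume)) ξ x := by
  set η := b.normed volume
  have hη : ContDiff ℝ ∞ η := b.contDiff_normed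
  have hc : HasCompactSupport η := b.hasCompactSupport_normed
  have hχ : ContDiff ℝ ∞ fun s => η (x - s) := hη.comp (contDiff_const.sub contDiff_id)
  have hχc : HasCompactSupport fun s => η (x - s) :=
    hc.comp_homeomorph (Homeomorph.subLeft x)
  have hsupp : tsupport (fun s => η (x - s)) ⊆ Metric.ball 0 R := by
    have h1 : tsupport (fun s => η (x - s)) ⊆ Metric.closedBall x b.rOut := by
      refine closure_minimal (fun s hs => ?_) Metric.isClosed_closedBall
      have h2 : x - s ∈ Function.support η := hs
      rw [b.support_normed_eq, mem_ball_zero_iff] at h2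
      rw [Metric.mem_closedBall, dist_comm, dist_eq_norm]
      exact h2.le
    refine h1.trans fun s hs => ?_
    rw [Metric.mem_closedBall, dist_eq_norm] at hs
    rw [mem_ball_zero_iff]
    calc ‖s‖ = ‖x + (s - x)‖ := by congr 1; abel
      _ ≤ ‖x‖ + ‖s - x‖ := norm_add_le _ _
      _ < R := by linarith
  have h := hD ξ _ hχ hχc hsupp fun s => b.nonneg_normed _
  have hχi : Integrable fun s => C * ‖ξ‖ ^ 2 * η (x - s) :=
    (hχ.continuous.integrable_of_hasCompactSupport hχc).const_mul _
  rw [integral_add hχi (integrable_mul_lineLaplacian hu hχ hχc ξ), integral_const_mul,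
    integral_sub_left_eq_self η volume x, b.integral_normed] at h
  rw [lineLaplacian_mollify hu hη hc]
  linarith

theorem abs_mollify_le {n : ℕ} {u : Cn n → ℝ} {M : ℝ}
    (hM : ∀ z, |u z| ≤ M) (b : ContDiffBump (0 : Cn n)) (x : Cn n) :
    |mollify u (b.normed volume) x| ≤ M := by
  set η := b.normed volume
  have hi : Integrable fun s => M * η (x - s) :=
    ((b.integrable_normed (μ := volume)).comp_sub_left x).const_mul _
  calc |mollify u η x| ≤ ∫ s, |u s * η (x - s)| := by
        rw [mollify_apply]; exact abs_integral_le_integral_abs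
    _ ≤ ∫ s, M * η (x - s) := by
        refine integral_mono_of_nonneg (Eventually.of_forall fun s => abs_nonneg _) hi
          (Eventually.of_forall fun s => ?_)
        simp only [abs_mul]
        rw [abs_of_nonneg (b.nonneg_normed (x - s))]
        exact mul_le_mul_of_nonneg_right (hM s) (b.nonneg_normed _)
    _ = M := by
        rw [integral_const_mul, integral_sub_left_eq_self η volume x, b.integral_normed, mul_one]

/-- A sequence of bump functions shrinking to the origin. -/
noncomputable def shrinkingBump (n : ℕ) (j : ℕ) : ContDiffBump (0 : Cn n) where
  rIn := 1 / (j + 1)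
  rOut := 2 / (j + 1)
  rIn_pos := by positivity
  rIn_lt_rOut := by gcongr; norm_num

theorem tendsto_shrinkingBump_rOut (n : ℕ) :
    Tendsto (fun j => (shrinkingBump n j).rOut) atTop (𝓝 0) := by
  have := (tendsto_one_div_add_atTop_nhds_zero_nat (𝕜 := ℝ)).const_mul 2
  simpa [shrinkingBump, div_eq_mul_inv] using this

/-- Convergence at Lebesgue points. It needs the ratio of outer to inner radius to stay bounded, and
here this ratio is always `2`. -/
theorem ae_tendsto_mollify {n : ℕ} {u : Cn n → ℝ} (hu : LocallyIntegrable u) :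
    ∀ᵐ x, Tendsto (fun j => mollify u ((shrinkingBump n j).normed volume) x) atTop
      (𝓝 (u x)) := by
  simp only [mollify_eq_normed_convolution]
  refine ContDiffBump.ae_convolution_tendsto_right_of_locallyIntegrable (K := 2)
    (tendsto_shrinkingBump_rOut n) (Eventually.of_forall fun j => ?_) hu
  simp [shrinkingBump, div_eq_mul_inv]

theorem ae_add_smul {n : ℕ} {p : Cn n → Prop} (hp : ∀ᵐ x, p x) (x : Cn n) {δ : ℝ} (hδ : δ ≠ 0) :
    ∀ᵐ ξ, p (x + δ • ξ) := by
  have h1 : Measure.QuasiMeasurePreserving (fun ξ : Cn n => δ • ξ) := by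
    refine ⟨measurable_const_smul δ, ?_⟩
    rw [Measure.map_addHaar_smul volume hδ]
    exact Measure.smul_absolutelyContinuous
  have h2 : Measure.QuasiMeasurePreserving (fun ξ : Cn n => x + ξ) :=
    (measurePreserving_add_left volume x).quasiMeasurePreserving
  exact (h2.comp h1).ae hp

/-! ### Passage to the limit: kernel inequalities for non-smooth functions -/

/-- The kernel averages of a mollification converge. -/
theorem tendsto_integral_mollify {n : ℕ} {u : Cn n → ℝ} (hu : LocallyIntegrable u) {M : ℝ}
    (hM : ∀ z, |u z| ≤ M) {k : Cn n → ℝ} (hk : Integrable k) (x : Cn n) {δ : ℝ} (hδ : δ ≠ 0) :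
    Tendsto (fun j => ∫ ξ, mollify u ((shrinkingBump n j).normed volume) (x + δ • ξ) * k ξ) atTop
      (𝓝 (∫ ξ, u (x + δ • ξ) * k ξ)) := by
  refine tendsto_integral_of_dominated_convergence (fun ξ => M * |k ξ|) (fun j => ?_)
    (hk.abs.const_mul M) (fun j => Eventually.of_forall fun ξ => ?_) ?_
  · refine AEStronglyMeasurable.mul (Continuous.aestronglyMeasurable ?_) hk.aestronglyMeasurable
    exact (contDiff_mollify hu (ContDiffBump.contDiff_normed _)
      (ContDiffBump.hasCompactSupport_normed _)).continuous.comp (by fun_prop)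
  · rw [Real.norm_eq_abs, abs_mul]
    exact mul_le_mul_of_nonneg_right (abs_mollify_le hM _ _) (abs_nonneg _)
  · filter_upwards [ae_add_smul (ae_tendsto_mollify hu) x hδ] with ξ hξ
    exact hξ.mul_const _

/-- The sub-mean value inequality for circular kernels at almost every point. -/
theorem ae_submean_kernel {n : ℕ} {u : Cn n → ℝ} (hu : LocallyIntegrable u) {M : ℝ}
    (hM : ∀ z, |u z| ≤ M) {R C : ℝ} (hC : 0 ≤ C) (hD : DistribLineLaplacianGe u R C)
    {k : Cn n → ℝ} (hk : IsCircularKernel k) {δ : ℝ} (hδ : 0 < δ) :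
    ∀ᵐ x, ‖x‖ + 2 * δ < R → (∫ ξ, k ξ) * (u x - C * δ ^ 2) ≤ ∫ ξ, u (x + δ • ξ) * k ξ := by
  filter_upwards [ae_tendsto_mollify hu] with x hx hxR
  refine le_of_tendsto_of_tendsto ((hx.sub_const _).const_mul _)
    (tendsto_integral_mollify hu hM hk.integrable x hδ.ne') ?_
  have h0 : ∀ᶠ j in atTop, (shrinkingBump n j).rOut < R - (‖x‖ + 2 * δ) :=
    (tendsto_shrinkingBump_rOut n).eventually_lt_const (by linarith)
  filter_upwards [h0] with j hj
  refine smooth_submean_kernel hk (contDiff_mollify hu (ContDiffBump.contDiff_normed _)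
    (ContDiffBump.hasCompactSupport_normed _)) (abs_mollify_le hM _) hC x hδ fun z hz ξ =>
      lineLaplacian_mollify_ge hu hD _ ?_ ξ
  have : ‖z‖ ≤ ‖x‖ + ‖z - x‖ := by
    calc ‖z‖ = ‖x + (z - x)‖ := by congr 1; abel
      _ ≤ _ := norm_add_le _ _
  linarith

/-- The averages of an integrable function against a bounded integrable kernel are continuous. -/
theorem continuous_integral_kernel {n : ℕ} {u : Cn n → ℝ} (hu : Integrable u)
    {k : Cn n → ℝ} (hk : Integrable k) {B : ℝ} (hB : ∀ ξ, |k ξ| ≤ B) {δ : ℝ} (hδ : 0 < δ) :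
    Continuous fun x => ∫ ξ, u (x + δ • ξ) * k ξ := by
  have hB0 : 0 ≤ B := (abs_nonneg _).trans (hB 0)
  set K : ℝ := |(δ ^ Module.finrank ℝ (Cn n))⁻¹|
  have hcomp : ∀ (f : Cn n → ℝ) (x : Cn n), ∫ ξ, f (x + δ • ξ) = K * ∫ z, f z := by
    intro f x
    rw [Measure.integral_comp_smul volume (fun ξ => f (x + ξ)) δ, integral_add_left_eq_self,
      smul_eq_mul]
  have hint : ∀ {f : Cn n → ℝ}, Integrable f → ∀ x : Cn n, Integrable fun ξ => f (x + δ • ξ) :=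
    fun hf x => (hf.comp_add_left x).comp_smul hδ.ne'
  -- Replacing `u` by a continuous compactly supported `h` that is close in `L¹` changes the average
  -- by at most `B K ‖u - h‖₁`, uniformly in `x`, where `K` is the Jacobian of the dilation.
  refine continuous_of_uniform_approx_of_continuous fun s hs => ?_
  obtain ⟨ε, hε, hεs⟩ := Metric.mem_uniformity_dist.1 hs
  obtain ⟨h, hhc, hhu, hhcont, hhi⟩ := hu.exists_hasCompactSupport_integral_sub_le
    (ε := ε / (2 * (B * K + 1))) (by positivity)
  refine ⟨fun x => ∫ ξ, h (x + δ • ξ) * k ξ, ?_, fun x => hεs ?_⟩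
  · obtain ⟨D, hD⟩ := hhcont.bounded_above_of_compact_support hhc
    refine continuous_of_dominated (bound := fun ξ => D * |k ξ|) (fun x => ?_)
      (fun x => Eventually.of_forall fun ξ => ?_) (hk.abs.const_mul D)
      (Eventually.of_forall fun ξ => ?_)
    · exact (hhcont.comp (by fun_prop)).aestronglyMeasurable.mul hk.aestronglyMeasurable
    · rw [norm_mul]
      exact mul_le_mul_of_nonneg_right (hD _) (abs_nonneg _)
    · exact (hhcont.comp (by fun_prop)).mul continuous_const
  · have hi1 : Integrable fun ξ => u (x + δ • ξ) * k ξ :=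
      (hint hu x).mul_bdd (c := B) hk.aestronglyMeasurable (Eventually.of_forall hB)
    have hi2 : Integrable fun ξ => h (x + δ • ξ) * k ξ :=
      (hint hhi x).mul_bdd (c := B) hk.aestronglyMeasurable (Eventually.of_forall hB)
    rw [Real.dist_eq, ← integral_sub hi1 hi2]
    calc |∫ ξ, (u (x + δ • ξ) * k ξ - h (x + δ • ξ) * k ξ)|
        ≤ ∫ ξ, |u (x + δ • ξ) * k ξ - h (x + δ • ξ) * k ξ| := abs_integral_le_integral_abs
      _ ≤ ∫ ξ, B * ‖u (x + δ • ξ) - h (x + δ • ξ)‖ := by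
          refine integral_mono (hi1.sub hi2).abs
            (((hint hu x).sub (hint hhi x)).norm.const_mul B) fun ξ => ?_
          simp only
          rw [← sub_mul, abs_mul, mul_comm, Real.norm_eq_abs]
          exact mul_le_mul_of_nonneg_right (hB ξ) (abs_nonneg _)
      _ = B * K * ∫ z, ‖u z - h z‖ := by
          rw [integral_const_mul, hcomp (fun z => ‖u z - h z‖), mul_assoc]
      _ ≤ B * K * (ε / (2 * (B * K + 1))) := by gcongr
      _ < ε := by
          have hK : 0 ≤ B * K := by positivity
          rw [mul_div_assoc', div_lt_iff₀ (by positivity)]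
          nlinarith

/-- Near the point `x` there are values of `u`, off any null set, that are not much smaller than
`u x`. -/
def EssentiallyAttained {n : ℕ} (u : Cn n → ℝ) (x : Cn n) : Prop :=
  ∀ p : Cn n → Prop, (∀ᵐ y, p y) → ∀ ε > 0, ∃ y, ‖y - x‖ < ε ∧ p y ∧ u x - ε < u y

/-- The sub-mean value inequality for circular kernels. -/
theorem submean_kernel {n : ℕ} {u : Cn n → ℝ} (hu : Integrable u) {M : ℝ}
    (hM : ∀ z, |u z| ≤ M) {R C : ℝ} (hC : 0 ≤ C) (hD : DistribLineLaplacianGe u R C)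
    (hE : ∀ x, ‖x‖ < R → EssentiallyAttained u x)
    {k : Cn n → ℝ} (hk : IsCircularKernel k) {δ : ℝ} (hδ : 0 < δ) {x : Cn n}
    (hx : ‖x‖ + 2 * δ < R) :
    (∫ ξ, k ξ) * (u x - C * δ ^ 2) ≤ ∫ ξ, u (x + δ • ξ) * k ξ := by
  obtain ⟨B, hB⟩ := hk.bounded
  have hB' : ∀ ξ, |k ξ| ≤ B := fun ξ => by rw [abs_of_nonneg (hk.nonneg ξ)]; exact hB ξ
  have hcont := continuous_integral_kernel hu hk.integrable hB' hδ
  have hae := ae_submean_kernel hu.locallyIntegrable hM hC hD hk hδ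
  have hk0 : 0 ≤ ∫ ξ, k ξ := integral_nonneg hk.nonneg
  refine le_of_forall_pos_le_add fun ε hε => ?_
  obtain ⟨r, hr, hr'⟩ := Metric.continuousAt_iff.1 (hcont.continuousAt (x := x)) (ε / 2)
    (half_pos hε)
  -- The three terms keep the average at `y` within `ε / 2` of that at `x`, keep `y` in the range of
  -- the almost everywhere inequality, and make the loss `s ∫ k` at most `ε / 2`.
  set s := min (min r (R - (‖x‖ + 2 * δ))) (ε / (2 * ((∫ ξ, k ξ) + 1)))
  have hs : 0 < s := by
    refine lt_min (lt_min hr (by linarith)) (by positivity)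
  obtain ⟨y, hyx, hy, huy⟩ := hE x (by linarith) _ hae s hs
  have h1 : ‖y - x‖ < r := hyx.trans_le ((min_le_left _ _).trans (min_le_left _ _))
  have h2 : ‖y - x‖ < R - (‖x‖ + 2 * δ) := hyx.trans_le ((min_le_left _ _).trans (min_le_right _ _))
  have h3 : s * (2 * ((∫ ξ, k ξ) + 1)) ≤ ε := by
    rw [← le_div_iff₀ (by positivity)]; exact min_le_right _ _
  have h4 : ‖y‖ ≤ ‖x‖ + ‖y - x‖ := by
    calc ‖y‖ = ‖x + (y - x)‖ := by congr 1; abel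
      _ ≤ _ := norm_add_le _ _
  have h5 := hy (by linarith)
  have h6 := (abs_lt.1 ((Real.dist_eq _ _).symm.trans_lt (hr' (by rwa [dist_eq_norm])))).2
  have h7 : (∫ ξ, k ξ) * (u x - s - C * δ ^ 2) ≤ (∫ ξ, k ξ) * (u y - C * δ ^ 2) :=
    mul_le_mul_of_nonneg_left (by linarith) hk0
  nlinarith

/-! ### Plurisubharmonic functions -/

/-- Each rotation preserves null sets, so for every `θ` the property holds for almost all `ξ`.
Fubini exchanges the two quantifiers. -/
theorem ae_circle_of_ae {n : ℕ} {p : Cn n → Prop} (hp : ∀ᵐ y, p y) (z : Cn n) :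
    ∀ᵐ ξ : Cn n, ∀ᵐ θ : ℝ, p (z + circlePoint ξ θ) := by
  obtain ⟨N, hpN, hNm, hN0⟩ := exists_measurable_superset_of_null (ae_iff.1 hp)
  have hc : ∀ᵐ θ : ℝ, ∀ᵐ ξ : Cn n, z + circlePoint ξ θ ∉ N := by
    refine Eventually.of_forall fun θ => ?_
    have h1 : Measure.QuasiMeasurePreserving (fun ξ : Cn n => circlePoint ξ θ) :=
      (measurePreserving_unit_smul (c := circleMap 0 1 θ) (by simp)).quasiMeasurePreserving
    have h2 : Measure.QuasiMeasurePreserving (fun ξ : Cn n => z + ξ) :=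
      (measurePreserving_add_left volume z).quasiMeasurePreserving
    exact (h2.comp h1).ae (measure_eq_zero_iff_ae_notMem.1 hN0)
  rw [Measure.ae_ae_comm] at hc
  · filter_upwards [hc] with ξ hξ
    filter_upwards [hξ] with θ hθ
    by_contra h
    exact hθ (hpN h)
  · have hm : Measurable fun q : ℝ × Cn n => z + circlePoint q.2 q.1 :=
      (continuous_const.add (continuous_circlePoint.comp continuous_swap)).measurable
    exact (hm hNm).compl

/-- If `u ≤ u z - ε` held almost everywhere on a small ball around `z`, it would hold almost
everywhere on almost every small circle centred at `z`, against the sub-mean value inequality on one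
of them. -/
theorem PlurisubharmonicOn.essentiallyAttained {n : ℕ} {u : Cn n → ℝ} {Ω : Set (Cn n)}
    (hu : PlurisubharmonicOn u Ω) (hΩ : IsOpen Ω) {z : Cn n} (hz : z ∈ Ω) :
    EssentiallyAttained u z := by
  intro p hp ε hε
  by_contra! hcon
  obtain ⟨r, hr, hrΩ⟩ := Metric.isOpen_iff.1 hΩ z hz
  obtain ⟨ξ, hξ, hξr⟩ := ((ae_circle_of_ae hp z).and_frequently
    (frequently_ae_mem_iff.2 ((Metric.isOpen_ball (x := (0 : Cn n)) (ε := min r ε)).measure_pos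
      volume ⟨0, by simp [hr, hε]⟩).ne')).exists
  rw [mem_ball_zero_iff, lt_min_iff] at hξr
  obtain ⟨hci, hle⟩ := hu.2 z ξ fun ζ hζ => hrΩ (by
    rw [Metric.mem_ball, dist_eq_norm, add_sub_cancel_left, norm_smul]
    calc _ ≤ 1 * ‖ξ‖ := mul_le_mul_of_nonneg_right hζ (norm_nonneg _)
      _ < r := by linarith [hξr.1])
  have hpi := Real.pi_pos
  have h1 : ∫ θ in (0 : ℝ)..2 * Real.pi, u (z + circleMap 0 1 θ • ξ) ≤
      ∫ θ in (0 : ℝ)..2 * Real.pi, (u z - ε) := by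
    refine intervalIntegral.integral_mono_ae (by positivity) hci intervalIntegrable_const ?_
    filter_upwards [hξ] with θ hθ
    refine hcon _ ?_ hθ
    rw [add_sub_cancel_left]
    exact (norm_circlePoint ξ θ).trans_lt hξr.2
  rw [intervalIntegral.integral_const, smul_eq_mul, sub_zero] at h1
  rw [Real.circleAverage_def, smul_eq_mul] at hle
  have h2 : (2 * Real.pi)⁻¹ * (∫ θ in (0 : ℝ)..2 * Real.pi, u (z + circleMap 0 1 θ • ξ)) ≤
      (2 * Real.pi)⁻¹ * (2 * Real.pi * (u z - ε)) :=
    mul_le_mul_of_nonneg_left h1 (by positivity)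
  rw [inv_mul_cancel_left₀ (by positivity)] at h2
  linarith

section Manifold

variable {n : ℕ} {X : Type*} [TopologicalSpace X] [ChartedSpace (Cn n) X]

theorem QuasiPlurisubharmonic.upperSemicontinuous {φ : X → ℝ}
    (hφ : QuasiPlurisubharmonic (n := n) φ) : UpperSemicontinuous φ := by
  intro x c hc
  obtain ⟨G, -, hx, w, hw, hψ⟩ := hφ x
  have hwc : ContinuousAt (fun y => w (G y)) x :=
    (hw.continuousOn.continuousAt (G.open_target.mem_nhds (G.map_source hx))).comp
      (G.continuousAt hx)
  have h1 := hψ.1 (G x) (G.map_source hx) (φ x + w (G x) + (c - φ x) / 2)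
    (by simp only [G.left_inv hx]; linarith)
  rw [nhdsWithin_eq_nhds.2 (G.open_target.mem_nhds (G.map_source hx))] at h1
  have h2 := (G.continuousAt hx).eventually h1
  have h3 := hwc.eventually_const_lt (u := w (G x) - (c - φ x) / 2) (by linarith)
  filter_upwards [h2, h3, G.open_source.mem_nhds hx] with y hy1 hy2 hy3
  simp only [G.left_inv hy3] at hy1
  linarith

theorem contDiffOn_transition [IsManifold 𝓘(ℂ, Cn n) ω X]
    {F G : OpenPartialHomeomorph X (Cn n)} (hF : F ∈ IsManifold.maximalAtlas 𝓘(ℂ, Cn n) ω X)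
    (hG : G ∈ IsManifold.maximalAtlas 𝓘(ℂ, Cn n) ω X) :
    ContDiffOn ℝ ∞ (fun z => G (F.symm z)) (F.symm ≫ₕ G).source := by
  have h := StructureGroupoid.compatible_of_mem_maximalAtlas hF hG
  rw [contDiffGroupoid, mem_groupoid_of_pregroupoid] at h
  have h1 : ContDiffOn ℂ ω (F.symm ≫ₕ G) (F.symm ≫ₕ G).source := by
    simpa [contDiffPregroupoid] using h.1
  exact (h1.restrict_scalars ℝ).of_le le_top

/-- The chart `G` in which `φ + w` is plurisubharmonic need not be `F`. The transition map is
smooth, hence sends null sets to null sets, and the continuity of `w` costs only part of `ε`. -/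
theorem QuasiPlurisubharmonic.essentiallyAttained [IsManifold 𝓘(ℂ, Cn n) ω X] {φ : X → ℝ}
    (hφ : QuasiPlurisubharmonic (n := n) φ) {F : OpenPartialHomeomorph X (Cn n)}
    (hF : F ∈ IsManifold.maximalAtlas 𝓘(ℂ, Cn n) ω X) {z : Cn n} (hz : z ∈ F.target) :
    EssentiallyAttained (fun z => φ (F.symm z)) z := by
  intro p hp ε hε
  obtain ⟨G, hG, hx, w, hw, hψ⟩ := hφ (F.symm z)
  set z' := G (F.symm z) with hz'
  have hz'G : z' ∈ G.target := G.map_source hx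
  -- the property `p` read in the chart `G`
  have hp' : ∀ᵐ y, y ∈ (G.symm ≫ₕ F).source → p (F (G.symm y)) := by
    have h0 : volume ({y | ¬ p y} ∩ (F.symm ≫ₕ G).source) = 0 :=
      measure_mono_null inter_subset_left hp
    have h1 := addHaar_image_eq_zero_of_differentiableOn_of_addHaar_eq_zero volume
      (((contDiffOn_transition hF hG).differentiableOn (by simp)).mono inter_subset_right) h0
    refine measure_mono_null (fun y hy => ?_) h1
    simp only [mem_compl_iff, mem_ofPred_eq, Classical.not_imp] at hy
    obtain ⟨hy1, hy2⟩ := hy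
    rw [OpenPartialHomeomorph.trans_source] at hy1
    simp only [OpenPartialHomeomorph.symm_source, mem_inter_iff, mem_preimage] at hy1
    refine ⟨F (G.symm y), ⟨hy2, ?_⟩, ?_⟩
    · simp [hy1, F.map_source, F.left_inv hy1.2,
        G.map_target hy1.1]
    · simp [F.left_inv hy1.2, G.right_inv hy1.1]
  have hz'S : z' ∈ (G.symm ≫ₕ F).source := by
    simp [hz', G.map_source hx, G.left_inv hx, F.map_target hz]
  have hcF : ContinuousAt (fun y => F (G.symm y)) z' :=
    (G.symm ≫ₕ F).continuousAt hz'S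
  have hwc : ContinuousAt w z' := hw.continuousOn.continuousAt (G.open_target.mem_nhds hz'G)
  have e1 : ∀ᶠ y in 𝓝 z', ‖F (G.symm y) - z‖ < ε := by
    have : F (G.symm z') = z := by rw [hz', G.left_inv hx, F.right_inv hz]
    have h := Metric.continuousAt_iff'.1 hcF ε hε
    simpa only [this, dist_eq_norm] using h
  have e2 : ∀ᶠ y in 𝓝 z', w y < w z' + ε / 2 := hwc.eventually_lt_const (by linarith)
  obtain ⟨r, hr, hrs⟩ := Metric.eventually_nhds_iff.1
    ((e1.and e2).and ((G.symm ≫ₕ F).open_source.mem_nhds hz'S))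
  obtain ⟨y, hy, hpy, huy⟩ := hψ.essentiallyAttained G.open_target hz'G _ hp' (min r (ε / 2))
    (lt_min hr (by linarith))
  obtain ⟨⟨h1, h2⟩, h3⟩ := hrs (y := y) (by rw [dist_eq_norm]; exact hy.trans_le (min_le_left _ _))
  refine ⟨F (G.symm y), h1, hpy h3, ?_⟩
  have h4 : min r (ε / 2) ≤ ε / 2 := min_le_right _ _
  simp only [hz', G.left_inv hx] at huy
  rw [OpenPartialHomeomorph.trans_source] at h3
  simp only [F.left_inv h3.2]
  simp only [hz'] at h2
  linarith

end Manifold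

/-! ### Moduli of continuity -/

namespace IsModulusOfContinuity

variable {l : ℝ} {κ : ℝ → ℝ}

theorem nonneg (hκ : IsModulusOfContinuity l κ) {t : ℝ} (ht : t ∈ Icc 0 l) : 0 ≤ κ t := by
  rcases ht.1.eq_or_lt with h | h
  · rw [← h, hκ.map_zero]
  · exact (hκ.pos t ⟨h, ht.2⟩).le

theorem natCast_mul_le (hκ : IsModulusOfContinuity l κ) (m : ℕ) {t : ℝ} (ht : 0 ≤ t)
    (hmt : m * t ≤ l) : κ (m * t) ≤ m * κ t := by
  induction m with
  | zero => simp [hκ.map_zero]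
  | succ m ih =>
    push_cast at hmt ⊢
    have h0 : 0 ≤ m * t := by positivity
    have h1 := hκ.subadditive (m * t) t h0 ht (by linarith)
    have h2 := ih (by linarith)
    rw [show ((m : ℝ) + 1) * t = m * t + t by ring]
    linarith

theorem mul_le (hκ : IsModulusOfContinuity l κ) {B t : ℝ} (hB : 0 < B) (ht : 0 ≤ t) (htl : t ≤ l)
    (hBt : B * t ≤ l) : κ (B * t) ≤ (B + 1) * κ t := by
  have hm : 0 < ⌈B⌉₊ := Nat.ceil_pos.2 hB
  have hm' : (0 : ℝ) < ⌈B⌉₊ := by exact_mod_cast hm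
  -- `B t` is cut into `⌈B⌉` equal pieces of length at most `t`.
  have h1 := hκ.natCast_mul_le ⌈B⌉₊ (t := B * t / ⌈B⌉₊) (by positivity)
    (by rwa [mul_div_cancel₀ _ hm'.ne'])
  rw [mul_div_cancel₀ _ hm'.ne'] at h1
  have h2 : B * t / ⌈B⌉₊ ≤ t := by
    rw [div_le_iff₀ hm', mul_comm t]
    exact mul_le_mul_of_nonneg_right (Nat.le_ceil B) ht
  have h3 : κ (B * t / ⌈B⌉₊) ≤ κ t :=
    hκ.monotoneOn ⟨by positivity, h2.trans htl⟩ ⟨ht, htl⟩ h2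
  have h4 : (⌈B⌉₊ : ℝ) ≤ B + 1 := (Nat.ceil_lt_add_one hB.le).le
  calc κ (B * t) ≤ ⌈B⌉₊ * κ (B * t / ⌈B⌉₊) := h1
    _ ≤ ⌈B⌉₊ * κ t := mul_le_mul_of_nonneg_left h3 hm'.le
    _ ≤ (B + 1) * κ t := mul_le_mul_of_nonneg_right h4 (hκ.nonneg ⟨ht, htl⟩)

/-- A modulus of continuity grows at least linearly. -/
theorem exists_le_mul (hκ : IsModulusOfContinuity l κ) :
    ∃ c : ℝ, 0 < c ∧ ∀ t ∈ Icc 0 l, t ≤ c * κ t := by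
  have hl := hκ.length_pos
  have hkl : 0 < κ l := hκ.pos l ⟨hl, le_rfl⟩
  refine ⟨2 * l / κ l, by positivity, fun t ht => ?_⟩
  rcases ht.1.eq_or_lt with h | h
  · rw [← h, hκ.map_zero, mul_zero]
  have h1 := hκ.mul_le (B := l / t) (t := t) (by positivity) ht.1 ht.2
    (by rw [div_mul_cancel₀ _ h.ne'])
  rw [div_mul_cancel₀ _ h.ne'] at h1
  rw [div_mul_eq_mul_div, le_div_iff₀ hkl]
  have h2 : l / t + 1 ≤ 2 * l / t := by
    rw [div_add_one h.ne', div_le_div_iff_of_pos_right h]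
    linarith [ht.2]
  have h3 : κ l ≤ 2 * l / t * κ t := h1.trans (mul_le_mul_of_nonneg_right h2 (hκ.nonneg ht))
  calc t * κ l ≤ t * (2 * l / t * κ t) := mul_le_mul_of_nonneg_left h3 ht.1
    _ = 2 * l * κ t := by field_simp

end IsModulusOfContinuity

/-- The growth condition in the form in which it is used. -/
theorem GrowthCondition.exists_bound {n : ℕ} (hn : 0 < n) {l : ℝ} {κ : ℝ → ℝ}
    (hκ : IsModulusOfContinuity l κ) (h : GrowthCondition n κ) :
    ∃ A q τ : ℝ, 4 * n < A ∧ 0 < q ∧ q < 1 ∧ 0 < τ ∧ A * τ ≤ l ∧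
      ∀ t, 0 < t → t ≤ τ → 4 * n * κ (A * t) ≤ q * (A * κ t) := by
  obtain ⟨A, hA, hlim⟩ := h
  have hl := hκ.length_pos
  have hn1 : (1 : ℝ) ≤ n := by exact_mod_cast hn
  have hev : ∀ᶠ t in 𝓝[>] (0 : ℝ), 0 < t ∧ t ≤ l ∧ A * t ≤ l := by
    have h1 : ∀ᶠ t in 𝓝 (0 : ℝ), t ≤ l := eventually_le_nhds hl
    have h2 : ∀ᶠ t in 𝓝 (0 : ℝ), A * t ≤ l := by
      have : Tendsto (fun t : ℝ => A * t) (𝓝 0) (𝓝 0) := by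
        simpa using (continuous_const_mul A).tendsto 0
      exact this.eventually_le_const hl
    filter_upwards [self_mem_nhdsWithin, nhdsWithin_le_nhds h1, nhdsWithin_le_nhds h2]
      with t ht ht1 ht2 using ⟨ht, ht1, ht2⟩
  -- A real `limsup` yields eventual upper bounds only for a quotient bounded above; subadditivity
  -- provides this.
  have hbdd : IsBoundedUnder (· ≤ ·) (𝓝[>] (0 : ℝ))
      (fun t : ℝ => 4 * n * κ (A * t) / (A * κ t)) := by
    refine isBoundedUnder_of_eventually_le (a := 4 * n * (A + 1) / A) ?_
    filter_upwards [hev] with t ht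
    have hkt := hκ.pos t ⟨ht.1, ht.2.1⟩
    have := hκ.mul_le hA ht.1.le ht.2.1 ht.2.2
    rw [div_le_div_iff₀ (by positivity) hA]
    calc 4 * n * κ (A * t) * A ≤ 4 * n * ((A + 1) * κ t) * A := by gcongr
      _ = 4 * n * (A + 1) * (A * κ t) := by ring
  obtain ⟨q, hq1, hq2⟩ := exists_between (max_lt hlim one_pos)
  have hq0 : 0 < q := (le_max_right _ _).trans_lt hq1
  have hlt := eventually_lt_of_limsup_lt ((le_max_left _ _).trans_lt hq1) hbdd
  obtain ⟨τ, hτ, hτs⟩ := mem_nhdsGT_iff_exists_Ioc_subset.1 (hlt.and hev)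
  have key : ∀ t, 0 < t → t ≤ τ → 4 * n * κ (A * t) ≤ q * (A * κ t) := by
    intro t ht htτ
    obtain ⟨h1, h2⟩ := hτs ⟨ht, htτ⟩
    have hkt := hκ.pos t ⟨ht, h2.2.1⟩
    rw [div_lt_iff₀ (by positivity)] at h1
    exact h1.le
  obtain ⟨-, hτ0, hτl, hAτ⟩ := hτs (right_mem_Ioc.2 hτ)
  refine ⟨A, q, τ, ?_, hq0, hq2, hτ, hAτ, key⟩
  have hkτ := hκ.pos τ ⟨hτ0, hτl⟩
  have hk := key τ hτ0 le_rfl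
  -- It remains to see `4n < A`. For `A ≥ 1`, monotonicity gives `4n ≤ q A`. For `A < 1`,
  -- subadditivity gives `A κ(τ) ≤ (1 + A) κ(A τ)`, so `4n ≤ 2`, which is impossible.
  rcases le_or_gt 1 A with hA1 | hA1
  · have h1 : κ τ ≤ κ (A * τ) :=
      hκ.monotoneOn ⟨hτ0.le, hτl⟩ ⟨by positivity, hAτ⟩ (by nlinarith)
    have h2 : 4 * n * κ τ ≤ q * A * κ τ := by
      have : 4 * n * κ τ ≤ 4 * n * κ (A * τ) := by gcongr
      linarith
    have h3 := le_of_mul_le_mul_right h2 hkτ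
    nlinarith
  · exfalso
    have h1 := hκ.mul_le (B := A⁻¹) (t := A * τ) (by positivity) (by positivity) hAτ
      (by rwa [inv_mul_cancel_left₀ hA.ne'])
    rw [inv_mul_cancel_left₀ hA.ne'] at h1
    have h2 : A * κ τ ≤ (1 + A) * κ (A * τ) := by
      calc A * κ τ ≤ A * ((A⁻¹ + 1) * κ (A * τ)) := by gcongr
        _ = (1 + A) * κ (A * τ) := by field_simp
    have h3 : 0 < κ (A * τ) := hκ.pos _ ⟨by positivity, hAτ⟩
    have h4 : 4 * n * κ (A * τ) ≤ 2 * κ (A * τ) := by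
      have h5 : q * (A * κ τ) ≤ 1 * (A * κ τ) := by gcongr
      nlinarith
    have h6 := le_of_mul_le_mul_right h4 h3
    linarith

/-! ### The self-convolution of a radial kernel -/

section Kernel

variable {n : ℕ} {ρ : Cn n → ℝ}

theorem IsRadialKernel.integrable (hρ : IsRadialKernel ρ) : Integrable ρ := by
  obtain ⟨M, hM⟩ := hρ.bounded
  refine integrable_of_bounded_of_support hρ.measurable (M := M) (R := 1) (fun ξ => ?_) hρ.support
  rw [abs_of_nonneg (hρ.nonneg ξ)]
  exact hM ξ

/-- If all the sets `{ρ ≥ 1/(m+1)}` were null, the integral of `ρ` would vanish. Inner regularity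
then supplies a compact set, for which translation is continuous in measure. -/
theorem IsRadialKernel.exists_isCompact_le (hρ : IsRadialKernel ρ) :
    ∃ (s : ℝ) (K : Set (Cn n)), 0 < s ∧ IsCompact K ∧ volume K ≠ 0 ∧ ∀ ξ ∈ K, s ≤ ρ ξ := by
  have h : ∃ m : ℕ, volume {ξ | 1 / ((m : ℝ) + 1) ≤ ρ ξ} ≠ 0 := by
    by_contra! hcon
    have h1 : ∀ᵐ ξ, ∀ m : ℕ, ¬ 1 / ((m : ℝ) + 1) ≤ ρ ξ :=
      ae_all_iff.2 fun m => measure_eq_zero_iff_ae_notMem.1 (hcon m)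
    have h2 : ρ =ᵐ[volume] 0 := by
      filter_upwards [h1] with ξ hξ
      refine le_antisymm ?_ (hρ.nonneg ξ)
      by_contra hpos
      obtain ⟨m, hm⟩ := exists_nat_one_div_lt (not_le.1 hpos)
      exact hξ m hm.le
    have h3 := hρ.integral_eq_one
    rw [integral_congr_ae h2] at h3
    simp at h3
  obtain ⟨m, hm⟩ := h
  obtain ⟨K, hKs, hK, hK0⟩ := (measurableSet_le measurable_const hρ.measurable).exists_lt_isCompact
    (pos_iff_ne_zero.2 hm)
  exact ⟨1 / ((m : ℝ) + 1), K, by positivity, hK, hK0.ne', fun ξ hξ => hKs hξ⟩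

theorem IsRadialKernel.integrable_mul_sub (hρ : IsRadialKernel ρ) (ζ : Cn n) :
    Integrable fun ξ => ρ ξ * ρ (ζ - ξ) := by
  obtain ⟨M, hM⟩ := hρ.bounded
  refine hρ.integrable.mul_bdd (c := M)
    (hρ.measurable.comp (measurable_const.sub measurable_id)).aestronglyMeasurable
    (Eventually.of_forall fun ξ => ?_)
  rw [Real.norm_of_nonneg (hρ.nonneg _)]
  exact hM _

open scoped Pointwise in
/-- The self-convolution of a radial kernel is bounded below near the origin. -/
theorem IsRadialKernel.exists_le_mollify_self (hρ : IsRadialKernel ρ) :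
    ∃ c r : ℝ, 0 < c ∧ 0 < r ∧ r ≤ 1 ∧ ∀ ζ, ‖ζ‖ < r → c ≤ mollify ρ ρ ζ := by
  obtain ⟨s, K, hs, hK, hK0, hsK⟩ := hρ.exists_isCompact_le
  have hKtop : volume K ≠ ⊤ := hK.measure_lt_top.ne
  have hKpos : 0 < volume.real K := ENNReal.toReal_pos hK0 hKtop
  -- For small `ζ` less than half of `ζ + K` lies outside `K`, so the intersection keeps at least
  -- half the measure of `K`.
  have hev := eventually_nhds_zero_measure_vadd_sdiff_lt (μ := volume) hK hK.isClosed
    (ε := volume K / 2) (by simpa using hK0)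
  obtain ⟨r, hr, hrs⟩ := Metric.eventually_nhds_iff.1 hev
  refine ⟨s ^ 2 * (volume.real K / 2), min r 1, by positivity, lt_min hr one_pos, min_le_right _ _,
    fun ζ hζ => ?_⟩
  have h1 : volume ((ζ +ᵥ K) \ K) < volume K / 2 :=
    hrs (by rw [dist_zero_right]; exact hζ.trans_le (min_le_left _ _))
  have hKζ : IsCompact (ζ +ᵥ K) := hK.vadd ζ
  have h2 : volume.real K / 2 ≤ volume.real ((ζ +ᵥ K) ∩ K) := by
    have h3 : volume.real (ζ +ᵥ K) = volume.real K := by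
      simp only [Measure.real, measure_vadd]
    have h4 : volume.real ((ζ +ᵥ K) \ K) ≤ volume.real K / 2 := by
      have := ENNReal.toReal_mono (by simp [ENNReal.div_eq_top, hKtop]) h1.le
      simpa [Measure.real, ENNReal.toReal_div] using this
    have h5 := measureReal_inter_add_sdiff (μ := volume) (s := ζ +ᵥ K) hK.measurableSet
      hKζ.measure_lt_top.ne
    linarith
  have hm : MeasurableSet ((ζ +ᵥ K) ∩ K) := hKζ.measurableSet.inter hK.measurableSet
  have hfin : volume ((ζ +ᵥ K) ∩ K) ≠ ⊤ := measure_ne_top_of_subset inter_subset_right hKtop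
  calc s ^ 2 * (volume.real K / 2) ≤ s ^ 2 * volume.real ((ζ +ᵥ K) ∩ K) := by gcongr
    _ = ∫ ξ in (ζ +ᵥ K) ∩ K, s ^ 2 := by rw [setIntegral_const, smul_eq_mul, mul_comm]
    _ ≤ ∫ ξ in (ζ +ᵥ K) ∩ K, ρ ξ * ρ (ζ - ξ) := by
        refine setIntegral_mono_on (integrableOn_const hfin)
          (hρ.integrable_mul_sub ζ).integrableOn hm fun ξ hξ => ?_
        obtain ⟨ξ', hξ', rfl⟩ := hξ.1
        -- Radial kernels are even, so on `(ζ + K) ∩ K` both factors are at least `s`.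
        have e1 : ρ (ζ - (ζ +ᵥ ξ')) = ρ ξ' := hρ.radial _ _ (by
          rw [vadd_eq_add, sub_add_cancel_left, norm_neg])
        have e2 := hsK _ hξ.2
        have e3 := hsK _ hξ'
        simp only [e1, sq]
        exact mul_le_mul e2 e3 hs.le (hs.le.trans e2)
    _ ≤ mollify ρ ρ ζ := setIntegral_le_integral (hρ.integrable_mul_sub ζ)
        (Eventually.of_forall fun ξ => mul_nonneg (hρ.nonneg _) (hρ.nonneg _))

/-- The self-convolution lives on the ball of radius `2`, which is why circular kernels are allowed
that support. -/
theorem IsRadialKernel.isCircularKernel_mollify_self (hρ : IsRadialKernel ρ) :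
    IsCircularKernel (mollify ρ ρ) where
  measurable := by
    have h : Measurable (Function.uncurry fun ζ ξ : Cn n => ρ ξ * ρ (ζ - ξ)) :=
      (hρ.measurable.comp measurable_snd).mul
        (hρ.measurable.comp (measurable_fst.sub measurable_snd))
    exact (h.stronglyMeasurable.integral_prod_right (ν := volume)).measurable
  nonneg ζ := integral_nonneg fun ξ => mul_nonneg (hρ.nonneg _) (hρ.nonneg _)
  bounded := by
    obtain ⟨M, hM⟩ := hρ.bounded
    refine ⟨M, fun ζ => ?_⟩
    calc mollify ρ ρ ζ ≤ ∫ ξ, ρ ξ * M :=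
          integral_mono (hρ.integrable_mul_sub ζ) (hρ.integrable.mul_const M) fun ξ =>
            mul_le_mul_of_nonneg_left (hM _) (hρ.nonneg ξ)
      _ = M := by rw [integral_mul_const, hρ.integral_eq_one, one_mul]
  circular c hc ζ := by
    rw [mollify_apply, mollify_apply, ← integral_unit_smul hc fun ξ => ρ ξ * ρ (c • ζ - ξ)]
    refine integral_congr_ae (Eventually.of_forall fun ξ => ?_)
    simp only [← smul_sub]
    rw [hρ.radial (c • ξ) ξ (by rw [norm_smul, hc, one_mul]),
      hρ.radial (c • (ζ - ξ)) (ζ - ξ) (by rw [norm_smul, hc, one_mul])]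
  support ζ hζ := by
    rw [mollify_apply]
    refine integral_eq_zero_of_ae (Eventually.of_forall fun ξ => ?_)
    rcases lt_or_ge 1 ‖ξ‖ with h | h
    · simp [hρ.support ξ h]
    · have : 1 < ‖ζ - ξ‖ := by linarith [norm_sub_norm_le ζ ξ]
      simp [hρ.support _ this]

theorem IsRadialKernel.integral_mollify_self (hρ : IsRadialKernel ρ) :
    ∫ ζ, mollify ρ ρ ζ = 1 := by
  have h := integral_convolution (ContinuousLinearMap.mul ℝ ℝ) hρ.integrable hρ.integrable
    (μ := volume) (ν := volume)
  rw [hρ.integral_eq_one] at h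
  exact h.trans (by simp)

/-- Regularizing twice is regularizing with the self-convolution. -/
theorem integral_mul_mollify_self (hρ : IsRadialKernel ρ) {u : Cn n → ℝ} (hu : Measurable u)
    {M : ℝ} (hM : ∀ z, |u z| ≤ M) (x : Cn n) (δ : ℝ) :
    ∫ ζ, u (x + δ • ζ) * mollify ρ ρ ζ
      = ∫ ξ, (∫ η, u (x + δ • ξ + δ • η) * ρ η) * ρ ξ := by
  have hint : Integrable (Function.uncurry fun ζ ξ : Cn n => u (x + δ • ζ) * (ρ ξ * ρ (ζ - ξ)))
      (volume.prod volume) := by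
    have h1 := hρ.integrable.convolution_integrand (ContinuousLinearMap.mul ℝ ℝ) hρ.integrable
    refine h1.bdd_mul (c := M) ?_ (Eventually.of_forall fun p => hM _)
    exact (hu.comp (by fun_prop)).aestronglyMeasurable
  calc ∫ ζ, u (x + δ • ζ) * mollify ρ ρ ζ
      = ∫ ζ, ∫ ξ, u (x + δ • ζ) * (ρ ξ * ρ (ζ - ξ)) := by
        simp only [integral_const_mul, mollify_apply]
    _ = ∫ ξ, ∫ ζ, u (x + δ • ζ) * (ρ ξ * ρ (ζ - ξ)) := integral_integral_swap hint
    _ = _ := by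
        refine integral_congr_ae (Eventually.of_forall fun ξ => ?_)
        simp only
        rw [← integral_add_right_eq_self _ ξ, ← integral_mul_const]
        refine integral_congr_ae (Eventually.of_forall fun η => ?_)
        simp only [add_sub_cancel_right, smul_add]
        rw [add_right_comm x, add_assoc x]
        ring_nf

end Kernel

/-! ### Upper bounds for means over balls -/

section BallMeans

variable {n : ℕ}

theorem setIntegral_ball_smul (f : Cn n → ℝ) (x : Cn n) {s : ℝ} (hs : 0 < s) (r : ℝ) :
    ∫ z in Metric.ball x (s * r), f z
      = s ^ Module.finrank ℝ (Cn n) * ∫ ζ in Metric.ball (0 : Cn n) r, f (x + s • ζ) := by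
  have h1 : ∀ ζ : Cn n, (Metric.ball (0 : Cn n) r).indicator (fun ζ => f (x + s • ζ)) ζ
      = (Metric.ball x (s * r)).indicator f (x + s • ζ) := by
    intro ζ
    have h2 : ζ ∈ Metric.ball (0 : Cn n) r ↔ x + s • ζ ∈ Metric.ball x (s * r) := by
      rw [mem_ball_zero_iff, Metric.mem_ball, dist_eq_norm, add_sub_cancel_left, norm_smul,
        Real.norm_of_nonneg hs.le, mul_lt_mul_iff_right₀ hs]
    by_cases h : ζ ∈ Metric.ball (0 : Cn n) r
    · rw [indicator_of_mem h, indicator_of_mem (h2.1 h)]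
    · rw [indicator_of_notMem h, indicator_of_notMem (mt h2.2 h)]
  rw [← integral_indicator measurableSet_ball, ← integral_indicator measurableSet_ball]
  simp only [h1]
  rw [Measure.integral_comp_smul volume
    (fun ζ => (Metric.ball x (s * r)).indicator f (x + ζ)) s, integral_add_left_eq_self,
    smul_eq_mul, abs_of_pos (by positivity), mul_inv_cancel_left₀ (by positivity)]

theorem volume_real_ball_smul (x : Cn n) {s : ℝ} (hs : 0 < s) (r : ℝ) :
    volume.real (Metric.ball x (s * r))
      = s ^ Module.finrank ℝ (Cn n) * volume.real (Metric.ball (0 : Cn n) r) := by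
  have h := setIntegral_ball_smul (fun _ : Cn n => 1) x hs r
  simpa using h

theorem volume_real_ball_pos (x : Cn n) {s : ℝ} (hs : 0 < s) :
    0 < volume.real (Metric.ball x s) :=
  ENNReal.toReal_pos (Metric.measure_ball_pos volume x hs).ne' measure_ball_lt_top.ne

theorem isCircularKernel_indicator_ball {r : ℝ} (hr : r ≤ 2) :
    IsCircularKernel ((Metric.ball (0 : Cn n) r).indicator fun _ => (1 : ℝ)) where
  measurable := measurable_const.indicator measurableSet_ball
  nonneg := indicator_nonneg fun _ _ => zero_le_one
  bounded := ⟨1, fun ξ => indicator_le_self' (fun _ _ => zero_le_one) ξ⟩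
  circular c hc ξ := by
    have h : c • ξ ∈ Metric.ball (0 : Cn n) r ↔ ξ ∈ Metric.ball (0 : Cn n) r := by
      rw [mem_ball_zero_iff, mem_ball_zero_iff, norm_smul, hc, one_mul]
    by_cases h' : ξ ∈ Metric.ball (0 : Cn n) r
    · rw [indicator_of_mem h', indicator_of_mem (h.2 h')]
    · rw [indicator_of_notMem h', indicator_of_notMem (mt h.1 h')]
  support ξ hξ := by
    refine indicator_of_notMem ?_ _
    rw [mem_ball_zero_iff]
    linarith

/-- What remains of a kernel after a ball is removed still obeys the sub-mean value inequality; the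
lower bound `c` on the ball keeps it nonnegative. -/
theorem IsCircularKernel.sub_indicator_ball {k : Cn n → ℝ} (hk : IsCircularKernel k) {c r : ℝ}
    (hc : 0 ≤ c) (hr : r ≤ 2) (h : ∀ ξ, ‖ξ‖ < r → c ≤ k ξ) :
    IsCircularKernel fun ξ =>
      k ξ - c * (Metric.ball (0 : Cn n) r).indicator (fun _ => (1 : ℝ)) ξ where
  measurable := hk.measurable.sub
    ((isCircularKernel_indicator_ball hr).measurable.const_mul c)
  nonneg ξ := by
    by_cases h' : ξ ∈ Metric.ball (0 : Cn n) r
    · have := h ξ (mem_ball_zero_iff.1 h')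
      simp only [indicator_of_mem h']
      linarith
    · simp only [indicator_of_notMem h', mul_zero, sub_zero]
      exact hk.nonneg ξ
  bounded := by
    obtain ⟨M, hM⟩ := hk.bounded
    refine ⟨M, fun ξ => ?_⟩
    have := mul_nonneg hc ((isCircularKernel_indicator_ball (n := n) hr).nonneg ξ)
    linarith [hM ξ]
  circular a ha ξ := by
    rw [hk.circular a ha, (isCircularKernel_indicator_ball hr).circular a ha]
  support ξ hξ := by
    rw [hk.support ξ hξ, (isCircularKernel_indicator_ball hr).support ξ hξ]
    simp

/-- The sub-mean value property of `u` on the ball of radius `R` for circular kernels, up to a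
quadratic error. -/
def SubmeanKernel (u : Cn n → ℝ) (R C : ℝ) : Prop :=
  ∀ k : Cn n → ℝ, IsCircularKernel k → ∀ δ : ℝ, 0 < δ → ∀ x : Cn n, ‖x‖ + 2 * δ < R →
    (∫ ξ, k ξ) * (u x - C * δ ^ 2) ≤ ∫ ξ, u (x + δ • ξ) * k ξ

theorem integral_mul_indicator_ball (f : Cn n → ℝ) (r : ℝ) :
    ∫ ξ, f ξ * (Metric.ball (0 : Cn n) r).indicator (fun _ => (1 : ℝ)) ξ
      = ∫ ξ in Metric.ball (0 : Cn n) r, f ξ := by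
  rw [← integral_indicator measurableSet_ball]
  refine integral_congr_ae (Eventually.of_forall fun ξ => ?_)
  by_cases h : ξ ∈ Metric.ball (0 : Cn n) r
  · simp only [indicator_of_mem h, mul_one]
  · simp only [indicator_of_notMem h, mul_zero]

theorem SubmeanKernel.le_ball_mean {u : Cn n → ℝ} {R C : ℝ} (hS : SubmeanKernel u R C)
    {x : Cn n} {s : ℝ} (hs : 0 < s) (hx : ‖x‖ + 2 * s < R) :
    (u x - C * s ^ 2) * volume.real (Metric.ball x s) ≤ ∫ z in Metric.ball x s, u z := by
  have h := hS _ (isCircularKernel_indicator_ball (r := 1) one_le_two) s hs x hx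
  rw [integral_mul_indicator_ball (fun ξ => u (x + s • ξ)),
    integral_indicator_const _ measurableSet_ball, smul_eq_mul, mul_one] at h
  have h1 := setIntegral_ball_smul u x hs 1
  have h2 := volume_real_ball_smul x hs 1
  rw [mul_one] at h1 h2
  rw [h1, h2]
  calc _ = s ^ Module.finrank ℝ (Cn n) *
        (volume.real (Metric.ball (0 : Cn n) 1) * (u x - C * s ^ 2)) := by ring
    _ ≤ _ := by gcongr

theorem integrable_comp_add_smul_mul {u : Cn n → ℝ} (hu : Measurable u) {M : ℝ}
    (hM : ∀ z, |u z| ≤ M) {k : Cn n → ℝ} (hk : Integrable k) (x : Cn n) (δ : ℝ) :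
    Integrable fun ξ => u (x + δ • ξ) * k ξ :=
  hk.bdd_mul (c := M) (hu.comp (by fun_prop)).aestronglyMeasurable
    (Eventually.of_forall fun ξ => hM _)

/-- The bound on the regularization of `u` gives a bound on its means over balls. -/
theorem exists_ball_mean_le {l : ℝ} {κ : ℝ → ℝ} (hκ : IsModulusOfContinuity l κ)
    {ρ : Cn n → ℝ} (hρ : IsRadialKernel ρ) {u : Cn n → ℝ} (hu : Measurable u) {M : ℝ}
    (hM : ∀ z, |u z| ≤ M) {R C : ℝ} (hC : 0 ≤ C) (hS : SubmeanKernel u R C)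
    {C₁ δ₁ : ℝ} (hC₁ : 0 < C₁) (hδ₁ : 0 < δ₁) (hδ₁l : δ₁ ≤ l)
    (hR : ∀ δ : ℝ, 0 < δ → δ < δ₁ → ∀ x : Cn n, ‖x‖ + δ < R →
      ∫ ξ, u (x + δ • ξ) * ρ ξ ≤ u x + C₁ * κ δ) :
    ∃ C₂ r : ℝ, 0 < C₂ ∧ 0 < r ∧ r ≤ 1 ∧ ∀ s, 0 < s → s < r * δ₁ → ∀ x : Cn n,
      ‖x‖ + 2 * (s / r) < R →
      ∫ z in Metric.ball x s, u z ≤ (u x + C₂ * κ s) * volume.real (Metric.ball x s) := by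
  obtain ⟨c, r, hc, hr, hr1, hcr⟩ := hρ.exists_le_mollify_self
  obtain ⟨L, hL, hLκ⟩ := hκ.exists_le_mul
  set σ := mollify ρ ρ
  have hσ : IsCircularKernel σ := hρ.isCircularKernel_mollify_self
  set V := volume.real (Metric.ball (0 : Cn n) r)
  have hV : 0 < V := volume_real_ball_pos 0 hr
  have hl := hκ.length_pos
  -- Two regularizations cost `2 C₁ κ(δ)` and the sub-mean error costs `C δ² ≤ C l L κ(δ)`. The sum
  -- is divided by the mass `c V` of the removed ball, and `r⁻¹ + 1` passes from `κ(δ) = κ(s / r)`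
  -- to `κ(s)`.
  refine ⟨(2 * C₁ + C * l * L) / (c * V) * (r⁻¹ + 1), r, by positivity, hr, hr1,
    fun s hs hsδ x hx => ?_⟩
  set δ := s / r
  have hδ : 0 < δ := by positivity
  have hδδ₁ : δ < δ₁ := by rw [div_lt_iff₀ hr]; linarith
  have hδl : δ ∈ Icc 0 l := ⟨hδ.le, by linarith⟩
  have hδr : δ * r = s := div_mul_cancel₀ _ hr.ne'
  have hκδ : κ δ ≤ (r⁻¹ + 1) * κ s := by
    have := hκ.mul_le (B := r⁻¹) (t := s) (by positivity) hs.le (by nlinarith)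
      (by rw [inv_mul_eq_div]; exact hδl.2)
    rwa [inv_mul_eq_div] at this
  -- two regularizations
  have h1 : ∫ ζ, u (x + δ • ζ) * σ ζ ≤ u x + 2 * (C₁ * κ δ) := by
    rw [integral_mul_mollify_self hρ hu hM]
    calc ∫ ξ, (∫ η, u (x + δ • ξ + δ • η) * ρ η) * ρ ξ
        ≤ ∫ ξ, (u (x + δ • ξ) + C₁ * κ δ) * ρ ξ := by
          refine integral_mono ?_ ?_ fun ξ => ?_
          · have hm : Measurable (Function.uncurry fun ξ η : Cn n =>
                u (x + δ • ξ + δ • η) * ρ η) :=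
              (hu.comp (by fun_prop)).mul (hρ.measurable.comp measurable_snd)
            refine hρ.integrable.bdd_mul (c := M)
              (hm.stronglyMeasurable.integral_prod_right (ν := volume)).aestronglyMeasurable
              (Eventually.of_forall fun ξ => ?_)
            refine (norm_integral_le_integral_norm _).trans ?_
            calc ∫ η, ‖u (x + δ • ξ + δ • η) * ρ η‖ ≤ ∫ η, M * ρ η := by
                  refine integral_mono
                    (integrable_comp_add_smul_mul hu hM hρ.integrable _ δ).norm
                    (hρ.integrable.const_mul M) fun η => ?_
                  simp only [norm_mul, Real.norm_of_nonneg (hρ.nonneg η)]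
                  exact mul_le_mul_of_nonneg_right (hM _) (hρ.nonneg η)
              _ = M := by rw [integral_const_mul, hρ.integral_eq_one, mul_one]
          · simp only [add_mul]
            exact (integrable_comp_add_smul_mul hu hM hρ.integrable x δ).add
              (hρ.integrable.const_mul _)
          · rcases lt_or_ge 1 ‖ξ‖ with h | h
            · simp [hρ.support ξ h]
            refine mul_le_mul_of_nonneg_right (hR δ hδ hδδ₁ _ ?_) (hρ.nonneg ξ)
            have e1 : ‖x + δ • ξ‖ ≤ ‖x‖ + δ * ‖ξ‖ := by
              refine (norm_add_le _ _).trans ?_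
              rw [norm_smul, Real.norm_of_nonneg hδ.le]
            nlinarith
      _ = (∫ ξ, u (x + δ • ξ) * ρ ξ) + C₁ * κ δ := by
          simp only [add_mul]
          rw [integral_add (integrable_comp_add_smul_mul hu hM hρ.integrable x δ)
            (hρ.integrable.const_mul _), integral_const_mul, hρ.integral_eq_one, mul_one]
      _ ≤ u x + 2 * (C₁ * κ δ) := by
          have := hR δ hδ hδδ₁ x (by linarith)
          linarith
  -- the sub-mean value property for the difference of kernels
  have h2 := hS _ (hσ.sub_indicator_ball hc.le (by linarith) hcr) δ hδ x hx
  have hi1 := integrable_comp_add_smul_mul hu hM hσ.integrable x δ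
  have hi2 := integrable_comp_add_smul_mul hu hM
    (isCircularKernel_indicator_ball (n := n) (r := r) (by linarith)).integrable x δ
  have h3 : ∫ ξ, (σ ξ - c * (Metric.ball (0 : Cn n) r).indicator (fun _ => (1 : ℝ)) ξ)
      = 1 - c * V := by
    rw [integral_sub hσ.integrable
      ((isCircularKernel_indicator_ball (by linarith)).integrable.const_mul c),
      hρ.integral_mollify_self, integral_const_mul, integral_indicator_const _ measurableSet_ball,
      smul_eq_mul, mul_one]
  have h4 : ∫ ξ, u (x + δ • ξ) *
      (σ ξ - c * (Metric.ball (0 : Cn n) r).indicator (fun _ => (1 : ℝ)) ξ)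
      = (∫ ξ, u (x + δ • ξ) * σ ξ) - c * ∫ ξ in Metric.ball (0 : Cn n) r, u (x + δ • ξ) := by
    rw [← integral_mul_indicator_ball (fun ξ => u (x + δ • ξ)), ← integral_const_mul,
      ← integral_sub hi1 (hi2.const_mul c)]
    refine integral_congr_ae (Eventually.of_forall fun ξ => ?_)
    simp only
    ring
  rw [h3, h4] at h2
  have hcV : 0 < c * V := by positivity
  have h5 : C * δ ^ 2 ≤ C * l * L * κ δ := by
    have := hLκ δ hδl
    calc C * δ ^ 2 = C * (δ * δ) := by ring
      _ ≤ C * (l * (L * κ δ)) := by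
        gcongr
        exact hδl.2
      _ = _ := by ring
  have h6 : c * ∫ ξ in Metric.ball (0 : Cn n) r, u (x + δ • ξ) ≤
      c * (V * (u x + (2 * C₁ + C * l * L) / (c * V) * κ δ)) := by
    have e : c * (V * (u x + (2 * C₁ + C * l * L) / (c * V) * κ δ))
        = c * V * u x + (2 * C₁ + C * l * L) * κ δ := by field_simp
    rw [e]
    have h7 : 0 ≤ c * V * (C * δ ^ 2) := by positivity
    nlinarith
  have h8 := le_of_mul_le_mul_left h6 hc
  have h9 := setIntegral_ball_smul u x hδ r
  have h10 := volume_real_ball_smul x hδ r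
  rw [hδr] at h9 h10
  rw [h9, h10]
  have hD : 0 ≤ (2 * C₁ + C * l * L) / (c * V) := by positivity
  calc δ ^ Module.finrank ℝ (Cn n) * ∫ ξ in Metric.ball (0 : Cn n) r, u (x + δ • ξ)
      ≤ δ ^ Module.finrank ℝ (Cn n) * (V * (u x + (2 * C₁ + C * l * L) / (c * V) *
        ((r⁻¹ + 1) * κ s))) := by
        refine mul_le_mul_of_nonneg_left (h8.trans ?_) (by positivity)
        gcongr
    _ = _ := by ring

end BallMeans

/-! ### The oscillation estimate, iterated over geometric scales -/

section Iteration

variable {n : ℕ}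

theorem finrank_real_Cn : Module.finrank ℝ (Cn n) = 2 * n := by
  rw [finrank_real_of_complex, finrank_euclideanSpace, Fintype.card_fin]

/-- Comparison of the value at `y` with the value at the centre `x` of a ball on which `u` is
bounded below. -/
theorem sub_le_of_ball_means {u : Cn n → ℝ} {M : ℝ} (hu : Measurable u) (hM : ∀ z, |u z| ≤ M)
    {x y : Cn n} {r s m e₁ e₂ : ℝ} (hr : 0 < r) (hs : 0 < s) (hxy : ‖y - x‖ + r ≤ s)
    (hm : ∀ z, ‖z - x‖ < s → u x - m ≤ u z)
    (h₁ : (u y - e₁) * volume.real (Metric.ball y r) ≤ ∫ z in Metric.ball y r, u z)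
    (h₂ : ∫ z in Metric.ball x s, u z ≤ (u x + e₂) * volume.real (Metric.ball x s)) :
    u y - u x ≤ e₁ - m + (s / r) ^ (2 * n) * (e₂ + m) := by
  set V := volume.real (Metric.ball (0 : Cn n) 1)
  have hV : 0 < V := volume_real_ball_pos 0 one_pos
  have hvol : ∀ (p : Cn n) {t : ℝ}, 0 < t →
      volume.real (Metric.ball p t) = t ^ (2 * n) * V := fun p t ht => by
    have := volume_real_ball_smul p ht 1
    rwa [mul_one, finrank_real_Cn] at this
  have hui : ∀ (p : Cn n) (t : ℝ), IntegrableOn u (Metric.ball p t) := fun p t =>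
    Measure.integrableOn_of_bounded (M := M) measure_ball_lt_top.ne hu.aestronglyMeasurable
      (Eventually.of_forall hM)
  have hci : ∀ (p : Cn n) (t : ℝ), IntegrableOn (fun _ => m - u x) (Metric.ball p t) := fun p t =>
    integrableOn_const measure_ball_lt_top.ne
  have hint : ∀ (p : Cn n) (t : ℝ), ∫ z in Metric.ball p t, (u z + (m - u x))
      = (∫ z in Metric.ball p t, u z) + (m - u x) * volume.real (Metric.ball p t) := fun p t => by
    rw [integral_add (hui p t) (hci p t), setIntegral_const, smul_eq_mul, mul_comm (m - u x)]
  have hsub : Metric.ball y r ⊆ Metric.ball x s := by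
    refine Metric.ball_subset_ball' ?_
    rw [dist_eq_norm]; linarith
  -- The integrand is nonnegative on the large ball by `hm`, so the integral increases with the
  -- domain.
  have h3 : ∫ z in Metric.ball y r, (u z + (m - u x)) ≤
      ∫ z in Metric.ball x s, (u z + (m - u x)) := by
    refine setIntegral_mono_set ((hui x s).add (hci x s)) ?_ hsub.eventuallyLE
    filter_upwards [ae_restrict_mem measurableSet_ball] with z hz
    have := hm z (by rwa [← dist_eq_norm])
    simp only [Pi.zero_apply]
    linarith
  rw [hint, hint, hvol y hr, hvol x hs] at h3
  rw [hvol y hr] at h₁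
  rw [hvol x hs] at h₂
  have h4 : (u y - e₁ + (m - u x)) * (r ^ (2 * n) * V) ≤ (e₂ + m) * (s ^ (2 * n) * V) := by
    linarith
  have h5 : u y - e₁ + (m - u x) ≤ (s / r) ^ (2 * n) * (e₂ + m) := by
    rw [div_pow, div_mul_eq_mul_div, le_div_iff₀ (by positivity)]
    have h6 : (u y - e₁ + (m - u x)) * r ^ (2 * n) * V ≤ s ^ (2 * n) * (e₂ + m) * V := by linarith
    exact le_of_mul_le_mul_right h6 hV
  linarith

/-- With `y = 2n/A ≤ 1/2`, Bernoulli gives `(1 - 1/A)^{2n} ≥ 1 - y`, and `1/(1 - y) ≤ 1 + 2y`. -/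
theorem pow_div_sub_one_le {A : ℝ} (hA : 4 * n < A) (hA1 : 1 < A) :
    (A / (A - 1)) ^ (2 * n) ≤ 1 + 4 * n / A := by
  have hA0 : 0 < A := by linarith
  have h1 : 1 + ((2 * n : ℕ) : ℝ) * (-(1 / A)) ≤ (1 + -(1 / A)) ^ (2 * n) :=
    one_add_mul_le_pow (by
      have : 1 / A ≤ 1 := by rw [div_le_one hA0]; exact hA1.le
      linarith) _
  push_cast at h1
  set y : ℝ := 2 * n / A
  have hy0 : 0 ≤ y := by positivity
  have hy : y ≤ 1 / 2 := by rw [div_le_iff₀ hA0]; linarith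
  have h2 : 1 - y ≤ ((A - 1) / A) ^ (2 * n) := by
    have e1 : 1 - y = 1 + 2 * n * (-(1 / A)) := by simp only [y]; ring
    have e2 : (A - 1) / A = 1 + -(1 / A) := by field_simp; ring
    rw [e1, e2]; exact h1
  have h3 : A / (A - 1) = ((A - 1) / A)⁻¹ := by rw [inv_div]
  rw [h3, inv_pow]
  have h4 : 4 * n / A = 2 * y := by simp only [y]; ring
  rw [h4]
  refine inv_le_of_inv_le₀ (by positivity) (le_trans ?_ h2)
  rw [inv_le_iff_one_le_mul₀ (by positivity)]
  nlinarith

/-- One step of the oscillation estimate: the bound `D K` at scale `s = A w` improves to `D k` at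
scale `w`. -/
theorem oscillation_step {u : Cn n → ℝ} {M : ℝ} (hu : Measurable u) (hM : ∀ z, |u z| ≤ M)
    {x y : Cn n} {A q D e E₁ C₂ s w K k : ℝ} (hA : 4 * n < A) (hA1 : 1 < A) (hw : 0 < w)
    (hs : A * w = s) (hxy : ‖y - x‖ ≤ w) (hC₂ : 0 ≤ C₂) (hE₁ : 0 ≤ E₁) (hD : 0 ≤ D) (hK : 0 ≤ K)
    (hk : 0 ≤ k) (hlow : ∀ z, ‖z - x‖ < s → u x - D * K ≤ u z)
    (h₁ : (u y - e) * volume.real (Metric.ball y (s - w)) ≤ ∫ z in Metric.ball y (s - w), u z)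
    (h₂ : ∫ z in Metric.ball x s, u z ≤ (u x + C₂ * K) * volume.real (Metric.ball x s))
    (he : e ≤ E₁ * K) (hq : 4 * n * K ≤ q * (A * k)) (hKk : K ≤ A * k)
    (hED : (E₁ + 2 * C₂) * A ≤ (1 - q) * D) :
    u y - u x ≤ D * k := by
  have hA0 : 0 < A := by linarith
  have hws : w < s := by rw [← hs]; exact lt_mul_of_one_lt_left hw hA1
  have hstep := sub_le_of_ball_means hu hM (r := s - w) (by linarith) (hw.trans hws) (by linarith)
    hlow h₁ h₂
  have hratio : s / (s - w) = A / (A - 1) := by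
    rw [← hs]
    have : A * w - w = w * (A - 1) := by ring
    rw [this, mul_comm A w, mul_div_mul_left _ _ hw.ne']
  rw [hratio] at hstep
  have hpow := pow_div_sub_one_le hA hA1
  have hε : 4 * n / A ≤ 1 := by rw [div_le_one hA0]; exact hA.le
  have hgk : 4 * n / A * K ≤ q * k := by
    rw [div_mul_eq_mul_div, div_le_iff₀ hA0]
    linarith
  -- The term `-D K` cancels the `1` in `1 + 4n/A`. Only `D (4n/A) K ≤ q D k` survives, and the room
  -- `(1 - q) D` absorbs the errors.
  calc u y - u x ≤ e - D * K + (A / (A - 1)) ^ (2 * n) * (C₂ * K + D * K) := hstep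
    _ ≤ E₁ * K - D * K + (1 + 4 * n / A) * (C₂ * K + D * K) := by gcongr
    _ = E₁ * K + (1 + 4 * n / A) * (C₂ * K) + D * (4 * n / A * K) := by ring
    _ ≤ E₁ * K + (1 + 1) * (C₂ * K) + D * (q * k) := by gcongr
    _ = (E₁ + 2 * C₂) * K + q * D * k := by ring
    _ ≤ (E₁ + 2 * C₂) * (A * k) + q * D * k := by gcongr
    _ = ((E₁ + 2 * C₂) * A) * k + q * D * k := by ring
    _ ≤ ((1 - q) * D) * k + q * D * k := by gcongr
    _ = D * k := by ring

/-- The local modulus of continuity. -/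
theorem exists_local_modulus (hn : 0 < n) {l : ℝ} {κ : ℝ → ℝ} (hκ : IsModulusOfContinuity l κ)
    (hgrowth : GrowthCondition n κ) {ρ : Cn n → ℝ} (hρ : IsRadialKernel ρ) {u : Cn n → ℝ}
    (hu : Measurable u) {M : ℝ} (hM : ∀ z, |u z| ≤ M) {a C : ℝ} (ha : 0 < a) (hC : 0 ≤ C)
    (hS : SubmeanKernel u (4 * a) C) {C₁ δ₁ : ℝ} (hC₁ : 0 < C₁) (hδ₁ : 0 < δ₁) (hδ₁l : δ₁ ≤ l)
    (hR : ∀ δ : ℝ, 0 < δ → δ < δ₁ → ∀ x : Cn n, ‖x‖ + δ < 4 * a →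
      ∫ ξ, u (x + δ • ξ) * ρ ξ ≤ u x + C₁ * κ δ) :
    ∃ D t₀ : ℝ, 0 < D ∧ 0 < t₀ ∧ t₀ ≤ l ∧ ∀ x y : Cn n, ‖x‖ < a → ‖y - x‖ ≤ t₀ →
      u y - u x ≤ D * κ ‖y - x‖ := by
  obtain ⟨A, q, τ, hA, hq0, hq1, hτ, hAτ, hgr⟩ := hgrowth.exists_bound hn hκ
  obtain ⟨C₂, r, hC₂, hr, hr1, hmean⟩ := exists_ball_mean_le hκ hρ hu hM hC hS hC₁ hδ₁ hδ₁l hR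
  obtain ⟨L, hL, hLκ⟩ := hκ.exists_le_mul
  have hl := hκ.length_pos
  have hn1 : (1 : ℝ) ≤ n := by exact_mod_cast hn
  have hA4 : 4 < A := by linarith
  have hA0 : 0 < A := by linarith
  have hM0 : 0 ≤ M := (abs_nonneg _).trans (hM 0)
  -- the initial scale
  obtain ⟨t₀, ht₀, ht₀τ, ht₀a, ht₀δ⟩ :
      ∃ t₀ : ℝ, 0 < t₀ ∧ t₀ ≤ A * τ ∧ t₀ ≤ a * r / 2 ∧ t₀ ≤ r * δ₁ / 2 :=
    ⟨min (min (A * τ) (a * r / 2)) (r * δ₁ / 2), by positivity,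
      (min_le_left _ _).trans (min_le_left _ _), (min_le_left _ _).trans (min_le_right _ _),
      min_le_right _ _⟩
  have ht₀l : t₀ ≤ l := ht₀τ.trans hAτ
  have hκ₀ : 0 < κ t₀ := hκ.pos t₀ ⟨ht₀, ht₀l⟩
  obtain ⟨E, hEdef⟩ : ∃ E, E = C * l * L + 2 * C₂ := ⟨_, rfl⟩
  -- The first term makes the bound trivial at the initial scale `t₀`; the second lets the inductive
  -- step close.
  obtain ⟨D, hDdef⟩ : ∃ D, D = max (2 * M / κ t₀) (E * A / (1 - q)) + 1 := ⟨_, rfl⟩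
  have hD0 : 0 < D := by
    have : 0 ≤ 2 * M / κ t₀ := by positivity
    have := le_max_left (2 * M / κ t₀) (E * A / (1 - q))
    rw [hDdef]; linarith
  have hD1 : 2 * M ≤ D * κ t₀ := by
    rw [← div_le_iff₀ hκ₀]
    exact (le_max_left _ _).trans (by rw [hDdef]; linarith)
  have hD2 : (C * l * L + 2 * C₂) * A ≤ (1 - q) * D := by
    rw [← hEdef, mul_comm (1 - q), ← div_le_iff₀ (by linarith)]
    exact (le_max_right _ _).trans (by rw [hDdef]; linarith)
  set t : ℕ → ℝ := fun k => t₀ / A ^ k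
  have htpos : ∀ k, 0 < t k := fun k => by positivity
  have hAt : ∀ k, A * t (k + 1) = t k := fun k => by
    simp only [t, pow_succ]; field_simp
  have htle : ∀ k, t k ≤ t₀ := fun k =>
    div_le_self ht₀.le (one_le_pow₀ (by linarith))
  have hκpos : ∀ k, 0 < κ (t k) := fun k => hκ.pos _ ⟨htpos k, (htle k).trans ht₀l⟩
  have htgr : ∀ k, 4 * n * κ (t k) ≤ q * (A * κ (t (k + 1))) := fun k => by
    have h := hgr (t (k + 1)) (htpos _) (by
      have := htle k
      rw [← hAt k] at this
      have h2 : A * t (k + 1) ≤ A * τ := this.trans ht₀τ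
      exact le_of_mul_le_mul_left h2 hA0)
    rwa [hAt] at h
  have htgr' : ∀ k, κ (t k) ≤ A * κ (t (k + 1)) := fun k => by
    have h1 := htgr k
    have h2 := hκpos (k + 1)
    have h3 := hκpos k
    have h4 : q * (A * κ (t (k + 1))) ≤ 1 * (A * κ (t (k + 1))) := by gcongr
    nlinarith
  have htr : ∀ k, t k ≤ a / 2 * (1 / 2) ^ k := fun k => by
    simp only [t]
    rw [div_le_iff₀ (by positivity), mul_assoc, ← mul_pow]
    have h1 : (1 : ℝ) ≤ (1 / 2 * A) ^ k := one_le_pow₀ (by linarith)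
    have h2 : t₀ ≤ a / 2 := by nlinarith
    exact h2.trans (le_mul_of_one_le_right (by positivity) h1)
  -- Each step uses the previous scale at nearby centres. The admissible radius therefore shrinks to
  -- `a (1 + 2⁻ᵏ)`, never below `a`, and `htr` makes the scales small enough to fit in the gaps.
  have main : ∀ k : ℕ, ∀ x y : Cn n, ‖x‖ < a * (1 + (1 / 2) ^ k) → ‖y - x‖ ≤ t k →
      u y - u x ≤ D * κ (t k) := by
    intro k
    induction k with
    | zero =>
      intro x y _ _
      have e : t 0 = t₀ := by simp [t]
      rw [e]
      have h1 := abs_le.1 (hM x)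
      have h2 := abs_le.1 (hM y)
      linarith
    | succ k ih =>
      intro x y hx hxy
      have hp : (1 / 2 : ℝ) ^ (k + 1) = (1 / 2) ^ k / 2 := by rw [pow_succ]; ring
      have hp1 : (1 / 2 : ℝ) ^ k ≤ 1 := pow_le_one₀ (by norm_num) (by norm_num)
      have hp0 : 0 < (1 / 2 : ℝ) ^ k := by positivity
      rw [hp] at hx
      clear hp
      have hs := htpos k
      have hs' := htpos (k + 1)
      have hst := hAt k
      have hsa := htr k
      generalize (1 / 2 : ℝ) ^ k = P at ih hx hsa hp1 hp0
      have haP : a * P ≤ a := mul_le_of_le_one_right ha.le hp1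
      have hsa' : t k ≤ a / 2 := by linarith
      have hxa : ‖x‖ ≤ 3 * a / 2 := by linarith
      set s := t k
      set w := t (k + 1)
      have hws : w < s := by rw [← hst]; exact lt_mul_of_one_lt_left hs' (by linarith)
      have hsr : s / r ≤ a / 2 := by
        rw [div_le_iff₀ hr]
        exact (htle k).trans (by linarith)
      have hyn : ‖y‖ ≤ ‖x‖ + ‖y - x‖ := by
        calc ‖y‖ = ‖x + (y - x)‖ := by congr 1; abel
          _ ≤ _ := norm_add_le _ _
      -- the lower bound on the large ball
      have hlow : ∀ z, ‖z - x‖ < s → u x - D * κ s ≤ u z := by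
        intro z hz
        have hzn : ‖z‖ ≤ ‖x‖ + ‖z - x‖ := by
          calc ‖z‖ = ‖x + (z - x)‖ := by congr 1; abel
            _ ≤ _ := norm_add_le _ _
        -- The induction hypothesis is centred at `z`, so an upper bound for `u x` becomes a lower
        -- bound for `u z`. Here `‖z‖ < a (1 + P/2) + a P/2`, the radius allowed at the previous
        -- scale.
        have := ih z x (by linarith) (by rw [norm_sub_rev]; exact hz.le)
        linarith
      have hm1 := hS.le_ball_mean (x := y) (s := s - w) (by linarith) (by linarith)
      have hm2 := hmean s hs (by linarith [htle k, mul_pos hr hδ₁]) x (by linarith)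
      have hsl : s ∈ Icc 0 l := ⟨hs.le, (htle k).trans ht₀l⟩
      refine oscillation_step hu hM hA (by linarith) hs' hst hxy hC₂.le
        (by positivity : 0 ≤ C * l * L) hD0.le (hκpos k).le (hκpos (k + 1)).le hlow hm1 hm2 ?_
        (htgr k) (htgr' k) hD2
      have h1 := hLκ s hsl
      calc C * (s - w) ^ 2 ≤ C * (l * (L * κ s)) := by
            refine mul_le_mul_of_nonneg_left ?_ hC
            calc (s - w) ^ 2 ≤ s ^ 2 := by
                  apply pow_le_pow_left₀ <;> linarith
              _ = s * s := sq s
              _ ≤ l * (L * κ s) := mul_le_mul hsl.2 h1 hs.le hl.le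
        _ = _ := by ring
  -- A distance between consecutive scales `t (k+1)` and `t k` costs the factor `A` in `κ (t k) ≤ A
  -- κ (t (k+1))`.
  refine ⟨D * A, t₀, by positivity, ht₀, ht₀l, fun x y hx hxy => ?_⟩
  rcases (norm_nonneg (y - x)).eq_or_lt with h0 | h0
  · rw [eq_comm, norm_eq_zero, sub_eq_zero] at h0
    subst h0
    simp [hκ.map_zero]
  -- the scale of `‖y - x‖`
  obtain ⟨k, hk1, hk2⟩ := exists_nat_pow_near (x := t₀ / ‖y - x‖) (y := A)
    (by rwa [le_div_iff₀ h0, one_mul]) (by linarith)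
  have h1 : ‖y - x‖ ≤ t k := by
    simp only [t]
    rw [le_div_iff₀ (by positivity), mul_comm]
    rwa [le_div_iff₀ h0] at hk1
  have h2 : t (k + 1) ≤ ‖y - x‖ := by
    simp only [t]
    rw [div_le_iff₀ (by positivity), mul_comm]
    rw [div_lt_iff₀ h0] at hk2
    exact hk2.le
  have hp0 : 0 < (1 / 2 : ℝ) ^ k := by positivity
  have h3 := main k x y
    (hx.trans_le (le_mul_of_one_le_right ha.le (le_add_of_nonneg_right hp0.le))) h1
  have h4 : κ (t (k + 1)) ≤ κ ‖y - x‖ :=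
    hκ.monotoneOn ⟨(htpos _).le, (htle _).trans ht₀l⟩ ⟨h0.le, hxy.trans ht₀l⟩ h2
  have h5 := htgr' k
  calc u y - u x ≤ D * κ (t k) := h3
    _ ≤ D * (A * κ (t (k + 1))) := by gcongr
    _ ≤ D * (A * κ ‖y - x‖) := by gcongr
    _ = _ := by ring

end Iteration

/-! ### Charts are locally Lipschitz for the Riemannian distance -/

section RiemannianDistance

open scoped NNReal ENNReal

variable {E : Type*} [NormedAddCommGroup E] [NormedSpace ℝ E]
  {H : Type*} [TopologicalSpace H] {I : ModelWithCorners ℝ E H}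
  {M : Type*} [TopologicalSpace M] [ChartedSpace H M]
  [RiemannianBundle (fun x : M => TangentSpace I x)]
  [IsManifold I 1 M]

/-- The chart displacement along a path is bounded by the length of the path. -/
theorem edist_extChartAt_le_pathELength (x : M) {C : ℝ≥0} {γ : ℝ → M}
    (hγ : ContMDiffOn 𝓘(ℝ, ℝ) I 1 γ (Icc 0 1))
    (hs : ∀ t ∈ Icc (0 : ℝ) 1, γ t ∈ (chartAt H x).source)
    (hC : ∀ t ∈ Icc (0 : ℝ) 1, ∀ v : TangentSpace I (γ t),
      ‖(show E from mfderiv I 𝓘(ℝ, E) (extChartAt I x) (γ t) v)‖ₑ ≤ C * ‖v‖ₑ) :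
    edist (extChartAt I x (γ 1)) (extChartAt I x (γ 0)) ≤ C * pathELength I γ 0 1 := by
  let γ' := extChartAt I x ∘ γ
  have hγ' : ContMDiffOn 𝓘(ℝ, ℝ) 𝓘(ℝ, E) 1 γ' (Icc 0 1) :=
    contMDiffOn_extChartAt.comp (I' := I) (t := (chartAt H x).source) hγ hs
  calc edist (extChartAt I x (γ 1)) (extChartAt I x (γ 0)) = ‖γ' 1 - γ' 0‖ₑ :=
        edist_eq_enorm_sub _ _
    _ ≤ ∫⁻ t in Icc 0 1, ‖derivWithin γ' (Icc 0 1) t‖ₑ := by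
        apply enorm_sub_le_lintegral_derivWithin_Icc_of_contDiffOn_Icc _ zero_le_one
        rwa [← contMDiffOn_iff_contDiffOn]
    _ = ∫⁻ t in Icc 0 1, ‖(show E from mfderivWithin 𝓘(ℝ, ℝ) 𝓘(ℝ, E) γ' (Icc 0 1) t 1)‖ₑ := by
        simp_rw [← fderivWithin_derivWithin, mfderivWithin_eq_fderivWithin]
        rfl
    _ ≤ ∫⁻ t in Icc 0 1, C * ‖mfderivWithin 𝓘(ℝ, ℝ) I γ (Icc 0 1) t 1‖ₑ := by
        apply setLIntegral_mono' measurableSet_Icc (fun t ht ↦ ?_)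
        have h : mfderivWithin 𝓘(ℝ, ℝ) 𝓘(ℝ, E) γ' (Icc 0 1) t =
            (mfderiv I 𝓘(ℝ, E) (extChartAt I x) (γ t)) ∘L
              (mfderivWithin 𝓘(ℝ, ℝ) I γ (Icc 0 1) t) := by
          apply mfderiv_comp_mfderivWithin
          · exact mdifferentiableAt_extChartAt (hs t ht)
          · exact hγ.mdifferentiableOn one_ne_zero t ht
          · rw [uniqueMDiffWithinAt_iff_uniqueDiffWithinAt]
            exact uniqueDiffOn_Icc zero_lt_one _ ht
        have h' : mfderivWithin 𝓘(ℝ, ℝ) 𝓘(ℝ, E) γ' (Icc 0 1) t 1 =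
            (mfderiv I 𝓘(ℝ, E) (extChartAt I x) (γ t))
              (mfderivWithin 𝓘(ℝ, ℝ) I γ (Icc 0 1) t 1) := DFunLike.congr_fun h 1
        rw [h']
        exact hC t ht _
    _ = C * pathELength I γ 0 1 := by
        rw [lintegral_const_mul' _ _ ENNReal.coe_ne_top,
          pathELength_eq_lintegral_mfderivWithin_Icc]

variable [IsContinuousRiemannianBundle E (fun x : M => TangentSpace I x)]

theorem eventually_enorm_mfderiv_extChartAt_apply_le (x : M) :
    ∃ C : ℝ≥0, 0 < C ∧ ∀ᶠ y in 𝓝 x, ∀ v : TangentSpace I y,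
      ‖(show E from mfderiv I 𝓘(ℝ, E) (extChartAt I x) y v)‖ₑ ≤ C * ‖v‖ₑ := by
  obtain ⟨C, hC0, hC⟩ := eventually_enorm_mfderiv_extChartAt_lt I x
  refine ⟨C, hC0, ?_⟩
  filter_upwards [hC] with y hy v
  exact (ContinuousLinearMap.le_opENorm _ _).trans (mul_le_mul_left hy.le ‖v‖ₑ)

/-- The preferred chart at `x` is Lipschitz near `x` for the Riemannian distance. -/
theorem exists_edist_extChartAt_le_riemannianEDist [RegularSpace M] (x : M) :
    ∃ C : ℝ≥0, 0 < C ∧ ∃ V ∈ 𝓝 x, ∀ y ∈ V, ∀ z ∈ V,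
      edist (extChartAt I x z) (extChartAt I x y) ≤ C * riemannianEDist I y z := by
  obtain ⟨C, hC0, hC⟩ := eventually_enorm_mfderiv_extChartAt_apply_le (I := I) x
  obtain ⟨c, hc0, hc⟩ := setOfPred_riemannianEDist_lt_subset_nhds I
    (inter_mem hC (chart_source_mem_nhds H x))
  -- Points within `c/4` of `x` are joined by paths of length below `c/2`. Such paths stay within
  -- `3c/4` of `x`, where the derivative of the chart is bounded.
  have hc4 : (0 : ℝ≥0∞) < ((c / 4 : ℝ≥0) : ℝ≥0∞) := by
    rw [ENNReal.coe_pos]; positivity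
  refine ⟨C, hC0, _, eventually_riemannianEDist_lt I x hc4, fun y hy z hz => ?_⟩
  simp only [mem_ofPred_eq] at hy hz
  have hyz : riemannianEDist I y z < ((c / 2 : ℝ≥0) : ℝ≥0∞) := by
    calc riemannianEDist I y z ≤ riemannianEDist I y x + riemannianEDist I x z :=
          riemannianEDist_triangle
      _ < ((c / 4 : ℝ≥0) : ℝ≥0∞) + ((c / 4 : ℝ≥0) : ℝ≥0∞) := by
          rw [riemannianEDist_comm]; exact ENNReal.add_lt_add hy hz
      _ = ((c / 2 : ℝ≥0) : ℝ≥0∞) := by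
          rw [← ENNReal.coe_add]; congr 1; ext; push_cast; ring
  have key : ∀ r, riemannianEDist I y z < r →
      edist (extChartAt I x z) (extChartAt I x y) / C ≤ r := by
    intro r hr
    obtain ⟨γ, hγ0, hγ1, hγ, hlen⟩ := exists_lt_of_riemannianEDist_lt (lt_min hr hyz)
    have hin : ∀ t ∈ Icc (0 : ℝ) 1, riemannianEDist I x (γ t) < c := by
      intro t ht
      have h1 : riemannianEDist I y (γ t) ≤ pathELength I γ 0 1 :=
        (riemannianEDist_le_pathELength (hγ.mono (Icc_subset_Icc le_rfl ht.2)) hγ0 rfl ht.1).trans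
          (pathELength_mono le_rfl ht.2)
      calc riemannianEDist I x (γ t) ≤ riemannianEDist I x y + riemannianEDist I y (γ t) :=
            riemannianEDist_triangle
        _ < ((c / 4 : ℝ≥0) : ℝ≥0∞) + ((c / 2 : ℝ≥0) : ℝ≥0∞) :=
            ENNReal.add_lt_add hy ((h1.trans_lt hlen).trans_le (min_le_right _ _))
        _ ≤ c := by
            rw [← ENNReal.coe_add, ENNReal.coe_le_coe, ← NNReal.coe_le_coe]
            push_cast
            linarith [c.coe_nonneg]
    have h2 := edist_extChartAt_le_pathELength x hγ (fun t ht => (hc (hin t ht)).2)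
      (fun t ht => (hc (hin t ht)).1)
    rw [hγ0, hγ1] at h2
    refine ENNReal.div_le_of_le_mul' (h2.trans ?_)
    gcongr
    exact hlen.le.trans (min_le_left _ _)
  have h3 := le_of_forall_gt_imp_ge_of_dense key
  rwa [ENNReal.div_le_iff_le_mul (Or.inl (by simpa using hC0.ne')) (Or.inl ENNReal.coe_ne_top),
    mul_comm] at h3

end RiemannianDistance

/-! ### The metric in holomorphic charts -/

section HermitianMetric

variable {n : ℕ} {X : Type*} [TopologicalSpace X] [ChartedSpace (Cn n) X]
  [IsManifold 𝓘(ℂ, Cn n) ω X]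

/-- Lets a holomorphic chart act on the real tangent bundle that carries the metric: its transition
maps are complex analytic, hence real smooth. -/
theorem mem_maximalAtlas_real {F : OpenPartialHomeomorph X (Cn n)}
    (hF : F ∈ IsManifold.maximalAtlas 𝓘(ℂ, Cn n) ω X) :
    F ∈ IsManifold.maximalAtlas 𝓘(ℝ, Cn n) ∞ X := by
  have key : ∀ G ∈ IsManifold.maximalAtlas 𝓘(ℂ, Cn n) ω X,
      ∀ G' ∈ IsManifold.maximalAtlas 𝓘(ℂ, Cn n) ω X,
      G.symm ≫ₕ G' ∈ contDiffGroupoid ∞ 𝓘(ℝ, Cn n) := by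
    intro G hG G' hG'
    rw [contDiffGroupoid, mem_groupoid_of_pregroupoid]
    constructor
    · simpa [contDiffPregroupoid, Function.comp_def] using contDiffOn_transition hG hG'
    · have h : (G.symm ≫ₕ G').symm = G'.symm ≫ₕ G := by
        rw [OpenPartialHomeomorph.trans_symm_eq_symm_trans_symm, OpenPartialHomeomorph.symm_symm]
      rw [← OpenPartialHomeomorph.symm_source, h]
      simpa [contDiffPregroupoid, Function.comp_def] using contDiffOn_transition hG' hG
  rw [IsManifold.mem_maximalAtlas_iff, mem_maximalAtlas_iff]
  intro e he
  have he' : e ∈ IsManifold.maximalAtlas 𝓘(ℂ, Cn n) ω X := IsManifold.subset_maximalAtlas he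
  exact ⟨key F hF e he', key e he' F hF⟩

theorem HermitianMetric.isContinuousRiemannianBundle (g : HermitianMetric n X) :
    letI : RiemannianBundle (fun x : X => TangentSpace 𝓘(ℝ, Cn n) x) :=
      ⟨g.toContMDiffRiemannianMetric.toRiemannianMetric⟩
    IsContinuousRiemannianBundle (Cn n) (fun x : X => TangentSpace 𝓘(ℝ, Cn n) x) :=
  letI : RiemannianBundle (fun x : X => TangentSpace 𝓘(ℝ, Cn n) x) :=
    ⟨g.toContMDiffRiemannianMetric.toRiemannianMetric⟩
  ⟨⟨g.inner, g.contMDiff.continuous, fun _ _ _ => rfl⟩⟩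

/-- The tangent map of `F.symm` is continuous, and so is the inner product on the tangent bundle. -/
theorem HermitianMetric.continuousOn_inChart (g : HermitianMetric n X)
    {F : OpenPartialHomeomorph X (Cn n)} (hF : F ∈ IsManifold.maximalAtlas 𝓘(ℂ, Cn n) ω X) :
    ContinuousOn (fun p : Cn n × Cn n => g.inChart F p.1 p.2) (F.target ×ˢ univ) := by
  let : RiemannianBundle (fun x : X => TangentSpace 𝓘(ℝ, Cn n) x) :=
    ⟨g.toContMDiffRiemannianMetric.toRiemannianMetric⟩
  have := g.isContinuousRiemannianBundle
  have h1 : ContinuousOn (fun p : Cn n × Cn n => (⟨F.symm p.1,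
      mfderiv 𝓘(ℝ, Cn n) 𝓘(ℝ, Cn n) F.symm p.1 p.2⟩ : TangentBundle 𝓘(ℝ, Cn n) X))
      (F.target ×ˢ univ) := by
    have h := (contMDiffOn_symm_of_mem_maximalAtlas
      (mem_maximalAtlas_real hF)).continuousOn_tangentMapWithin (by simp)
      F.open_target.uniqueMDiffOn
    have h' := h.comp (tangentBundleModelSpaceHomeomorph 𝓘(ℝ, Cn n)).symm.continuous.continuousOn
      (s := F.target ×ˢ univ) (fun p hp => hp.1)
    refine h'.congr fun p hp => ?_
    have hw := mfderivWithin_of_isOpen (I := 𝓘(ℝ, Cn n)) (I' := 𝓘(ℝ, Cn n)) (f := F.symm)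
      F.open_target hp.1
    change _ = (⟨F.symm p.1, mfderivWithin 𝓘(ℝ, Cn n) 𝓘(ℝ, Cn n) F.symm F.target p.1 p.2⟩ :
      TangentBundle 𝓘(ℝ, Cn n) X)
    rw [hw]
  have h2 := ContinuousOn.inner_bundle (F := Cn n) (E := fun x : X => TangentSpace 𝓘(ℝ, Cn n) x)
    h1 h1
  exact h2

theorem HermitianMetric.inChart_smul (g : HermitianMetric n X)
    (F : OpenPartialHomeomorph X (Cn n)) (z ξ : Cn n) (t : ℝ) :
    g.inChart F z (t • ξ) = t ^ 2 * g.inChart F z ξ := by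
  have h : mfderiv 𝓘(ℝ, Cn n) 𝓘(ℝ, Cn n) F.symm z (t • ξ)
      = t • mfderiv 𝓘(ℝ, Cn n) 𝓘(ℝ, Cn n) F.symm z ξ := ContinuousLinearMap.map_smul _ _ _
  simp only [HermitianMetric.inChart]
  rw [h, map_smul, map_smul, smul_apply, smul_eq_mul, smul_eq_mul]
  ring

/-- A Hermitian metric is bounded on compact parts of a chart. -/
theorem HermitianMetric.exists_inChart_le (g : HermitianMetric n X)
    {F : OpenPartialHomeomorph X (Cn n)} (hF : F ∈ IsManifold.maximalAtlas 𝓘(ℂ, Cn n) ω X)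
    {K : Set (Cn n)} (hK : IsCompact K) (hKF : K ⊆ F.target) :
    ∃ C : ℝ, 0 ≤ C ∧ ∀ z ∈ K, ∀ ξ, g.inChart F z ξ ≤ C * ‖ξ‖ ^ 2 := by
  obtain ⟨C, hC⟩ := (hK.prod (isCompact_closedBall (0 : Cn n) 1)).exists_bound_of_continuousOn
    ((g.continuousOn_inChart hF).mono (prod_mono hKF (subset_univ _)))
  refine ⟨|C|, abs_nonneg C, fun z hz ξ => ?_⟩
  rcases eq_or_ne ξ 0 with rfl | hξ
  · have := g.inChart_smul F z 0 0
    rw [smul_zero, zero_pow two_ne_zero, zero_mul] at this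
    rw [this]
    positivity
  have hξ' : ‖ξ‖ ≠ 0 := norm_ne_zero_iff.2 hξ
  have h1 : g.inChart F z (‖ξ‖⁻¹ • ξ) ≤ |C| :=
    (le_abs_self _).trans ((hC (z, ‖ξ‖⁻¹ • ξ) ⟨hz, by
      rw [mem_closedBall_zero_iff, norm_smul, norm_inv, norm_norm, inv_mul_cancel₀ hξ']⟩).trans
      (le_abs_self C))
  have h2 := g.inChart_smul F z (‖ξ‖⁻¹ • ξ) ‖ξ‖
  rw [smul_inv_smul₀ hξ'] at h2
  rw [h2, mul_comm]
  gcongr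

end HermitianMetric

/-! ### `φ` read on a ball of a chart -/

theorem lineLaplacian_eq_zero_of_notMem_tsupport {n : ℕ} {χ : Cn n → ℝ} {z : Cn n}
    (hz : z ∉ tsupport χ) (ξ : Cn n) : lineLaplacian χ ξ z = 0 := by
  have h : fderiv ℝ (fderiv ℝ χ) z = 0 := image_eq_zero_of_notMem_tsupport
    fun h => hz (tsupport_fderiv_subset ℝ (tsupport_fderiv_subset ℝ h))
  simp [lineLaplacian_eq_fderiv, h]

section Manifold

variable {n : ℕ} {X : Type*} [TopologicalSpace X]

/-- The function `φ` read in the chart `F` on the ball of radius `R`, extended by zero. -/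
noncomputable def ballPullback (F : OpenPartialHomeomorph X (Cn n)) (R : ℝ) (φ : X → ℝ) :
    Cn n → ℝ :=
  (Metric.ball (0 : Cn n) R).indicator fun z => φ (F.symm z)

variable {F : OpenPartialHomeomorph X (Cn n)} {R : ℝ} {φ : X → ℝ}

theorem ballPullback_of_lt {z : Cn n} (hz : ‖z‖ < R) : ballPullback F R φ z = φ (F.symm z) :=
  indicator_of_mem (mem_ball_zero_iff.2 hz) _

theorem abs_ballPullback_le {M : ℝ} (hM : ∀ x, |φ x| ≤ M) (hM0 : 0 ≤ M) (z : Cn n) :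
    |ballPullback F R φ z| ≤ M := by
  unfold ballPullback
  by_cases h : z ∈ Metric.ball (0 : Cn n) R
  · rw [indicator_of_mem h]; exact hM _
  · rw [indicator_of_notMem h, abs_zero]; exact hM0

theorem measurable_ballPullback (hφ : UpperSemicontinuous φ)
    (hR : Metric.ball (0 : Cn n) R ⊆ F.target) : Measurable (ballPullback F R φ) := by
  have hopen : ∀ c, IsOpen (Metric.ball (0 : Cn n) R ∩ {z | φ (F.symm z) < c}) := by
    intro c
    rw [isOpen_iff_mem_nhds]
    rintro z ⟨hz, hzc⟩
    exact inter_mem (Metric.isOpen_ball.mem_nhds hz)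
      ((F.continuousAt_symm (hR hz)).eventually (hφ (F.symm z) c hzc))
  refine measurable_of_Iio fun c => ?_
  have h : ballPullback F R φ ⁻¹' Iio c = (Metric.ball (0 : Cn n) R ∩ {z | φ (F.symm z) < c}) ∪
      ((Metric.ball (0 : Cn n) R)ᶜ ∩ {_z | (0 : ℝ) < c}) := by
    ext z
    by_cases hz : z ∈ Metric.ball (0 : Cn n) R
    · simp [ballPullback, mem_ball_zero_iff.1 hz]
    · have hz' : R ≤ ‖z‖ := by simpa using hz
      simp [ballPullback, hz']
  rw [h]
  exact (hopen c).measurableSet.union (measurableSet_ball.compl.inter (MeasurableSet.const _))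

variable [ChartedSpace (Cn n) X] [IsManifold 𝓘(ℂ, Cn n) ω X]

theorem QuasiPlurisubharmonic.essentiallyAttained_ballPullback
    (hφ : QuasiPlurisubharmonic (n := n) φ) (hF : F ∈ IsManifold.maximalAtlas 𝓘(ℂ, Cn n) ω X)
    (hR : Metric.ball (0 : Cn n) R ⊆ F.target) {x : Cn n} (hx : ‖x‖ < R) :
    EssentiallyAttained (ballPullback F R φ) x := by
  intro p hp ε hε
  obtain ⟨y, hy, hpy, huy⟩ := hφ.essentiallyAttained hF (hR (mem_ball_zero_iff.2 hx)) p hp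
    (min ε (R - ‖x‖)) (lt_min hε (by linarith))
  have h1 := hy.trans_le (min_le_left _ _)
  have h2 := hy.trans_le (min_le_right _ _)
  have h3 : min ε (R - ‖x‖) ≤ ε := min_le_left _ _
  have h4 : ‖y‖ ≤ ‖x‖ + ‖y - x‖ := by
    calc ‖y‖ = ‖x + (y - x)‖ := by congr 1; abel
      _ ≤ _ := norm_add_le _ _
  refine ⟨y, h1, hpy, ?_⟩
  rw [ballPullback_of_lt hx, ballPullback_of_lt (by linarith)]
  linarith

/-- The metric is at most `C ‖ξ‖²` on the compact closed ball, so it may be replaced by this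
constant weight against nonnegative test functions. -/
theorem HermitianMetric.IsPlurisubharmonic.exists_distribLineLaplacianGe
    {g : HermitianMetric n X} (hφ : g.IsPlurisubharmonic φ)
    (hF : F ∈ IsManifold.maximalAtlas 𝓘(ℂ, Cn n) ω X)
    (hR : Metric.closedBall (0 : Cn n) R ⊆ F.target)
    (hu : LocallyIntegrable (ballPullback F R φ)) :
    ∃ C : ℝ, 0 ≤ C ∧ DistribLineLaplacianGe (ballPullback F R φ) R C := by
  obtain ⟨C, hC0, hC⟩ := g.exists_inChart_le hF (isCompact_closedBall (0 : Cn n) R) hR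
  refine ⟨C, hC0, fun ξ χ hχ hχc hχs hχ0 => ?_⟩
  have hsR : tsupport χ ⊆ F.target := hχs.trans (Metric.ball_subset_closedBall.trans hR)
  have h := hφ.2 F hF ξ χ hχ hχc hsR hχ0
  have e1 : ∀ z, φ (F.symm z) * lineLaplacian χ ξ z
      = ballPullback F R φ z * lineLaplacian χ ξ z := by
    intro z
    by_cases hz : z ∈ tsupport χ
    · rw [ballPullback_of_lt (mem_ball_zero_iff.1 (hχs hz))]
    · rw [lineLaplacian_eq_zero_of_notMem_tsupport hz, mul_zero, mul_zero]
  simp only [e1] at h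
  refine h.trans (integral_mono ?_ ?_ fun z => ?_)
  · refine Integrable.add ?_ (integrable_mul_lineLaplacian hu hχ hχc ξ)
    have hcont : ContinuousOn (fun z => g.inChart F z ξ * χ z) (tsupport χ) := by
      refine ContinuousOn.mul ?_ hχ.continuous.continuousOn
      exact (g.continuousOn_inChart hF).comp (f := fun z => (z, ξ)) (by fun_prop)
        fun z hz => ⟨hsR hz, mem_univ _⟩
    refine (integrableOn_iff_integrable_of_support_subset fun z hz => ?_).1
      (hcont.integrableOn_compact hχc)
    by_contra hz'
    exact hz (by simp [image_eq_zero_of_notMem_tsupport hz'])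
  · exact ((hχ.continuous.integrable_of_hasCompactSupport hχc).const_mul _).add
      (integrable_mul_lineLaplacian hu hχ hχc ξ)
  · by_cases hz : z ∈ tsupport χ
    · have := hC z (Metric.ball_subset_closedBall (hχs hz)) ξ
      have := mul_le_mul_of_nonneg_right this (hχ0 z)
      simp only
      linarith
    · simp [image_eq_zero_of_notMem_tsupport hz]

end Manifold

/-! ### The regularization hypothesis on a ball of a chart -/

section Kernel

variable {n : ℕ} {ρ : Cn n → ℝ}

theorem IsRadialKernel.setIntegral_ball_eq (hρ : IsRadialKernel ρ) (f : Cn n → ℝ) :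
    ∫ ξ in Metric.ball (0 : Cn n) 1, f ξ * ρ ξ = ∫ ξ, f ξ * ρ ξ := by
  have h : (Metric.ball (0 : Cn n) 1 : Set (Cn n)) =ᵐ[volume] Metric.closedBall (0 : Cn n) 1 := by
    refine Metric.ball_subset_closedBall.eventuallyLE.antisymm ?_
    have h0 : volume (Metric.sphere (0 : Cn n) 1) = 0 :=
      Measure.addHaar_sphere_of_ne_zero volume 0 one_ne_zero
    filter_upwards [measure_eq_zero_iff_ae_notMem.1 h0] with z hz hz'
    rw [Metric.mem_sphere] at hz
    exact lt_of_le_of_ne hz' hz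
  rw [setIntegral_congr_set h]
  refine setIntegral_eq_integral_of_forall_compl_eq_zero fun ξ hξ => ?_
  rw [mem_closedBall_zero_iff, not_le] at hξ
  rw [hρ.support ξ hξ, mul_zero]

end Kernel

/-- `Metric.infDist` to the empty set is `0`, so the frontier must be nonempty; this uses that a
bounded set is not all of `ℂⁿ` when `n > 0`. -/
theorem mem_shrink_of_norm_add_lt {n : ℕ} (hn : 0 < n) {Ω : Set (Cn n)} (hΩ : IsOpen Ω)
    (hb : Bornology.IsBounded Ω) {R δ : ℝ} (hR : Metric.ball (0 : Cn n) R ⊆ Ω)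
    {z : Cn n} (hδ : 0 < δ) (hz : ‖z‖ + δ < R) : z ∈ shrink Ω δ := by
  have hzΩ : z ∈ Ω := hR (mem_ball_zero_iff.2 (by linarith))
  have : Nonempty (Fin n) := ⟨⟨0, hn⟩⟩
  have : Nontrivial (Cn n) := inferInstance
  have hfr : (frontier Ω).Nonempty := by
    rw [nonempty_frontier_iff]
    refine ⟨⟨z, hzΩ⟩, fun h => ?_⟩
    rw [h] at hb
    exact NormedSpace.unbounded_univ ℝ (Cn n) hb
  refine ⟨hzΩ, ?_⟩
  obtain ⟨δ', h1, h2⟩ := exists_between (show δ < R - ‖z‖ by linarith)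
  refine h1.trans_le ((Metric.le_infDist hfr).2 fun y hy => ?_)
  by_contra! hlt
  have hy2 : y ∈ Ω := hR (by
    rw [mem_ball_zero_iff]
    have h3 : ‖y‖ ≤ ‖z‖ + ‖y - z‖ := by
      calc ‖y‖ = ‖z + (y - z)‖ := by congr 1; abel
        _ ≤ _ := norm_add_le _ _
    rw [dist_comm, dist_eq_norm] at hlt
    linarith)
  rw [hΩ.frontier_eq] at hy
  exact hy.2 hy2

/-! ### From charts to the geodesic distance and to all of `X` -/

theorem toReal_min_mem_Icc {l : ℝ} (hl : 0 ≤ l) (d : ENNReal) :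
    (min d (ENNReal.ofReal l)).toReal ∈ Icc 0 l := by
  refine ⟨ENNReal.toReal_nonneg, ?_⟩
  have := ENNReal.toReal_mono ENNReal.ofReal_ne_top (min_le_right d (ENNReal.ofReal l))
  rwa [ENNReal.toReal_ofReal hl] at this

/-- A modulus of continuity is comparable under Lipschitz changes of the distance. -/
theorem IsModulusOfContinuity.le_of_le_mul {l : ℝ} {κ : ℝ → ℝ} (hκ : IsModulusOfContinuity l κ)
    {K s : ℝ} (hK : 0 ≤ K) (hs : s ∈ Icc 0 l) {d : ENNReal}
    (hd : ENNReal.ofReal s ≤ ENNReal.ofReal K * d) :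
    κ s ≤ (K + 1) * κ (min d (ENNReal.ofReal l)).toReal := by
  have hl := hκ.length_pos
  rcases le_or_gt (ENNReal.ofReal l) d with h | h
  · rw [min_eq_right h, ENNReal.toReal_ofReal hl.le]
    have h1 : κ s ≤ κ l := hκ.monotoneOn hs ⟨hl.le, le_rfl⟩ hs.2
    have h2 := hκ.nonneg ⟨hl.le, le_rfl⟩
    nlinarith
  rw [min_eq_left h.le]
  have hdt : d ≠ ⊤ := h.ne_top
  set m := d.toReal
  have hm0 : 0 ≤ m := ENNReal.toReal_nonneg
  have hml : m ≤ l := by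
    have := ENNReal.toReal_mono ENNReal.ofReal_ne_top h.le
    rwa [ENNReal.toReal_ofReal hl.le] at this
  have hsm : s ≤ K * m := by
    have := ENNReal.toReal_mono (ENNReal.mul_ne_top ENNReal.ofReal_ne_top hdt) hd
    rwa [ENNReal.toReal_mul, ENNReal.toReal_ofReal hs.1, ENNReal.toReal_ofReal hK] at this
  have hκm := hκ.nonneg ⟨hm0, hml⟩
  rcases hs.1.eq_or_lt with h0 | h0
  · rw [← h0, hκ.map_zero]
    positivity
  have hm : 0 < m := by
    rcases hm0.eq_or_lt with h1 | h1
    · rw [← h1] at hsm; linarith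
    · exact h1
  have h1 := hκ.mul_le (B := s / m) (t := m) (by positivity) hm0 hml
    (by rw [div_mul_cancel₀ _ hm.ne']; exact hs.2)
  rw [div_mul_cancel₀ _ hm.ne'] at h1
  have h2 : s / m ≤ K := by rwa [div_le_iff₀ hm]
  exact h1.trans (mul_le_mul_of_nonneg_right (by linarith) hκm)

section Manifold

open scoped NNReal

variable {n : ℕ} {X : Type*} [TopologicalSpace X] [ChartedSpace (Cn n) X]
  [IsManifold 𝓘(ℂ, Cn n) ω X] {g : HermitianMetric n X}

/-- Holomorphic charts are locally Lipschitz for the geodesic distance. -/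
theorem HermitianMetric.exists_norm_sub_le_geodesicEDist [RegularSpace X] (g : HermitianMetric n X)
    {F : OpenPartialHomeomorph X (Cn n)} (hF : F ∈ IsManifold.maximalAtlas 𝓘(ℂ, Cn n) ω X)
    {x₀ : X} (hx₀ : x₀ ∈ F.source) :
    ∃ K : ℝ, 0 ≤ K ∧ ∃ V ∈ 𝓝 x₀, ∀ x ∈ V, ∀ y ∈ V,
      ENNReal.ofReal ‖F y - F x‖ ≤ ENNReal.ofReal K * g.geodesicEDist x y := by
  let : RiemannianBundle (fun x : X => TangentSpace 𝓘(ℝ, Cn n) x) :=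
    ⟨g.toContMDiffRiemannianMetric.toRiemannianMetric⟩
  have := g.isContinuousRiemannianBundle
  obtain ⟨C, -, V, hV, hVC⟩ := exists_edist_extChartAt_le_riemannianEDist (I := 𝓘(ℝ, Cn n)) x₀
  set e := chartAt (Cn n) x₀
  have he : e ∈ IsManifold.maximalAtlas 𝓘(ℂ, Cn n) ω X := IsManifold.chart_mem_maximalAtlas x₀
  have hx₀e : x₀ ∈ e.source := mem_chart_source (Cn n) x₀
  have hmem : e x₀ ∈ (e.symm ≫ₕ F).source := by
    simp [e.map_source hx₀e, e.left_inv hx₀e, hx₀]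
  have hT : ContDiffAt ℝ 1 (fun z => F (e.symm z)) (e x₀) :=
    ((contDiffOn_transition he hF).contDiffAt
      ((e.symm ≫ₕ F).open_source.mem_nhds hmem)).of_le (by simp)
  obtain ⟨L, t, ht, hL⟩ := hT.exists_lipschitzOnWith
  refine ⟨L * C, by positivity, V ∩ (e ⁻¹' t ∩ e.source),
    inter_mem hV (inter_mem ((e.continuousAt hx₀e).preimage_mem_nhds ht)
      (e.open_source.mem_nhds hx₀e)), fun x hx y hy => ?_⟩
  have h1 := hL hy.2.1 hx.2.1
  simp only [e.left_inv hy.2.2, e.left_inv hx.2.2] at h1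
  have h2 : edist (e y) (e x) ≤ C * g.geodesicEDist x y := hVC x hx.1 y hy.1
  rw [← dist_eq_norm, ← edist_dist]
  calc edist (F y) (F x) ≤ L * edist (e y) (e x) := h1
    _ ≤ L * (C * g.geodesicEDist x y) := by gcongr
    _ = ENNReal.ofReal (L * C) * g.geodesicEDist x y := by
        rw [ENNReal.ofReal_mul L.coe_nonneg, ENNReal.ofReal_coe_nnreal, ENNReal.ofReal_coe_nnreal,
          mul_assoc]

variable {l : ℝ} {κ : ℝ → ℝ} {ρ : Cn n → ℝ} {φ : X → ℝ}

/-- The modulus of continuity in a chart around a given point. -/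
theorem exists_chart_modulus (hn : 0 < n) (hκ : IsModulusOfContinuity l κ)
    (hgrowth : GrowthCondition n κ) (hρ : IsRadialKernel ρ) {M : ℝ} (hM : ∀ x, |φ x| ≤ M)
    (hφ : g.IsPlurisubharmonic φ) (hreg : LocalRegularizationBound l κ ρ φ) (x₀ : X) :
    ∃ F ∈ IsManifold.maximalAtlas 𝓘(ℂ, Cn n) ω X, x₀ ∈ F.source ∧
      ∃ D : ℝ, 0 < D ∧ ∃ W ∈ 𝓝 x₀, ∀ x ∈ W, ∀ y ∈ W,
        ‖F y - F x‖ ≤ l ∧ φ y - φ x ≤ D * κ ‖F y - F x‖ := by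
  obtain ⟨F, hF, C₁, δ₁, hC₁, hδ₁, hδ₁l, hbound⟩ := hreg x₀
  have hM0 : 0 ≤ M := (abs_nonneg _).trans (hM x₀)
  have h0 : (0 : Cn n) ∈ F.target := hF.map_center ▸ F.map_source hF.mem_source
  obtain ⟨r, hr, hrF⟩ := Metric.nhds_basis_closedBall.mem_iff.1 (F.open_target.mem_nhds h0)
  set a := r / 4
  have ha : 0 < a := by positivity
  have har : 4 * a = r := by simp only [a]; ring
  rw [← har] at hrF
  have hball : Metric.ball (0 : Cn n) (4 * a) ⊆ F.target :=
    Metric.ball_subset_closedBall.trans hrF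
  set u := ballPullback F (4 * a) φ
  have hum : Measurable u := measurable_ballPullback hφ.1.upperSemicontinuous hball
  have huM : ∀ z, |u z| ≤ M := abs_ballPullback_le hM hM0
  have hui : Integrable u := integrable_of_bounded_of_support hum huM (R := 4 * a) fun z hz =>
    indicator_of_notMem (by rw [mem_ball_zero_iff]; linarith) _
  obtain ⟨C, hC0, hD⟩ := hφ.exists_distribLineLaplacianGe hF.holomorphic hrF hui.locallyIntegrable
  have hS : SubmeanKernel u (4 * a) C := fun k hk δ hδ x hx =>
    submean_kernel hui huM hC0 hD
      (fun z hz => hφ.1.essentiallyAttained_ballPullback hF.holomorphic hball hz) hk hδ hx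
  have hR : ∀ δ : ℝ, 0 < δ → δ < δ₁ → ∀ x : Cn n, ‖x‖ + δ < 4 * a →
      ∫ ξ, u (x + δ • ξ) * ρ ξ ≤ u x + C₁ * κ δ := by
    intro δ hδ hδδ₁ x hx
    have hxF : x ∈ F.target := hball (mem_ball_zero_iff.2 (by linarith))
    have h1 := hbound δ hδ hδδ₁ (F.symm x) (F.map_target hxF) (by
      rw [F.right_inv hxF]
      exact mem_shrink_of_norm_add_lt hn F.open_target hF.bounded hball hδ hx)
    rw [localRegularization, regularize, F.right_inv hxF] at h1
    have h2 : ∫ ξ in Metric.ball (0 : Cn n) 1, φ (F.symm (x + δ • ξ)) * ρ ξ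
        = ∫ ξ in Metric.ball (0 : Cn n) 1, u (x + δ • ξ) * ρ ξ := by
      refine setIntegral_congr_fun measurableSet_ball fun ξ hξ => ?_
      rw [mem_ball_zero_iff] at hξ
      rw [show u (x + δ • ξ) = φ (F.symm (x + δ • ξ)) from ballPullback_of_lt ?_]
      calc ‖x + δ • ξ‖ ≤ ‖x‖ + ‖δ • ξ‖ := norm_add_le _ _
        _ = ‖x‖ + δ * ‖ξ‖ := by rw [norm_smul, Real.norm_of_nonneg hδ.le]
        _ < 4 * a := by nlinarith
    rw [h2, hρ.setIntegral_ball_eq (fun ξ => u (x + δ • ξ))] at h1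
    rw [show u x = φ (F.symm x) from ballPullback_of_lt (by linarith)]
    linarith
  obtain ⟨D, t₀, hD0, ht₀, ht₀l, hmod⟩ :=
    exists_local_modulus hn hκ hgrowth hρ hum huM ha hC0 hS hC₁ hδ₁ hδ₁l hR
  -- Points of the ball of radius `b` are admissible centres and lie within `t₀` of each other.
  set b := min a (t₀ / 2)
  have hb : 0 < b := by positivity
  have hba : b ≤ a := min_le_left _ _
  have hbt : b ≤ t₀ / 2 := min_le_right _ _
  refine ⟨F, hF.holomorphic, hF.mem_source, D, hD0, F.source ∩ F ⁻¹' Metric.ball 0 b,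
    inter_mem (F.open_source.mem_nhds hF.mem_source)
      ((F.continuousAt hF.mem_source).preimage_mem_nhds
        (by rw [hF.map_center]; exact Metric.ball_mem_nhds _ hb)), fun x hx y hy => ?_⟩
  have hxb : ‖F x‖ < b := mem_ball_zero_iff.1 hx.2
  have hyb : ‖F y‖ < b := mem_ball_zero_iff.1 hy.2
  have hxy : ‖F y - F x‖ ≤ t₀ := (norm_sub_le _ _).trans (by linarith)
  refine ⟨hxy.trans ht₀l, ?_⟩
  have h := hmod (F x) (F y) (by linarith) hxy
  rwa [show u (F y) = φ (F.symm (F y)) from ballPullback_of_lt (by linarith),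
    show u (F x) = φ (F.symm (F x)) from ballPullback_of_lt (by linarith),
    F.left_inv hx.1, F.left_inv hy.1] at h

/-- The modulus of continuity for the geodesic distance near a given point. -/
theorem exists_local_geodesic_modulus [RegularSpace X] (hκ : IsModulusOfContinuity l κ)
    (hgrowth : GrowthCondition n κ) (hρ : IsRadialKernel ρ) {M : ℝ} (hM : ∀ x, |φ x| ≤ M)
    (hφ : g.IsPlurisubharmonic φ) (hreg : LocalRegularizationBound l κ ρ φ) (x₀ : X) :
    ∃ D : ℝ, 0 < D ∧ ∃ W ∈ 𝓝 x₀, ∀ x ∈ W, ∀ y ∈ W,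
      |φ x - φ y| ≤ D * κ (min (g.geodesicEDist x y) (ENNReal.ofReal l)).toReal := by
  have hl := hκ.length_pos
  -- In dimension `0` the chart is injective into a single point, so a neighbourhood of `x₀` has
  -- only one element.
  rcases Nat.eq_zero_or_pos n with rfl | hn
  · obtain ⟨F, hF, -⟩ := hreg x₀
    refine ⟨1, one_pos, F.source, F.open_source.mem_nhds hF.mem_source, fun x hx y hy => ?_⟩
    rw [F.injOn hx hy (Subsingleton.elim _ _), sub_self, abs_zero, one_mul]
    exact hκ.nonneg (toReal_min_mem_Icc hl.le _)
  obtain ⟨F, hF, hx₀, D, hD, W, hW, hmod⟩ := exists_chart_modulus hn hκ hgrowth hρ hM hφ hreg x₀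
  obtain ⟨K, hK, V, hV, hlip⟩ := g.exists_norm_sub_le_geodesicEDist hF hx₀
  refine ⟨D * (K + 1), by positivity, W ∩ V, inter_mem hW hV, fun x hx y hy => ?_⟩
  obtain ⟨h1, h2⟩ := hmod x hx.1 y hy.1
  have h3 := (hmod y hy.1 x hx.1).2
  rw [norm_sub_rev] at h3
  have h4 := hκ.le_of_le_mul hK ⟨norm_nonneg _, h1⟩ (hlip x hx.2 y hy.2)
  have h5 : |φ x - φ y| ≤ D * κ ‖F y - F x‖ := abs_le.2 ⟨by linarith, h3⟩
  calc |φ x - φ y| ≤ D * κ ‖F y - F x‖ := h5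
    _ ≤ D * ((K + 1) * _) := mul_le_mul_of_nonneg_left h4 hD.le
    _ = _ := by ring

/-- The modulus of continuity for pairs of points one of which is near a given point. -/
theorem exists_semilocal_geodesic_modulus [RegularSpace X] (hκ : IsModulusOfContinuity l κ)
    (hgrowth : GrowthCondition n κ) (hρ : IsRadialKernel ρ) {M : ℝ} (hM : ∀ x, |φ x| ≤ M)
    (hφ : g.IsPlurisubharmonic φ) (hreg : LocalRegularizationBound l κ ρ φ) (x₀ : X) :
    ∃ V ∈ 𝓝 x₀, ∃ D : ℝ, 0 < D ∧ ∀ x ∈ V, ∀ y,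
      |φ x - φ y| ≤ D * κ (min (g.geodesicEDist x y) (ENNReal.ofReal l)).toReal := by
  have hl := hκ.length_pos
  have hM0 : 0 ≤ M := (abs_nonneg _).trans (hM x₀)
  obtain ⟨D, hD, W, hW, hmod⟩ := exists_local_geodesic_modulus hκ hgrowth hρ hM hφ hreg x₀
  obtain ⟨c, hc0, hcW, hcV⟩ : ∃ c : ℝ≥0, 0 < c ∧ {y | g.geodesicEDist x₀ y < c} ⊆ W ∧
      {y | g.geodesicEDist x₀ y < (c / 2 : ℝ≥0)} ∈ 𝓝 x₀ := by
    let : RiemannianBundle (fun x : X => TangentSpace 𝓘(ℝ, Cn n) x) :=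
      ⟨g.toContMDiffRiemannianMetric.toRiemannianMetric⟩
    have := g.isContinuousRiemannianBundle
    obtain ⟨c, hc0, hcW⟩ := setOfPred_riemannianEDist_lt_subset_nhds 𝓘(ℝ, Cn n) hW
    exact ⟨c, hc0, hcW, eventually_riemannianEDist_lt 𝓘(ℝ, Cn n) x₀
      (c := (c / 2 : ℝ≥0)) (by rw [ENNReal.coe_pos]; positivity)⟩
  have htri : ∀ x y, g.geodesicEDist x₀ y ≤ g.geodesicEDist x₀ x + g.geodesicEDist x y := by
    intro x y
    let : RiemannianBundle (fun x : X => TangentSpace 𝓘(ℝ, Cn n) x) :=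
      ⟨g.toContMDiffRiemannianMetric.toRiemannianMetric⟩
    exact riemannianEDist_triangle
  -- Pairs at distance at least `c/2` have `κ ≥ κ m₀ > 0`, so the trivial bound `2M` is at most `(2M
  -- / κ m₀) κ`.
  set m₀ := (min ((c / 2 : ℝ≥0) : ENNReal) (ENNReal.ofReal l)).toReal
  have hm₀ : 0 < m₀ := ENNReal.toReal_pos
    (lt_min (by rw [ENNReal.coe_pos]; positivity) (ENNReal.ofReal_pos.2 hl)).ne'
    (min_lt_of_left_lt ENNReal.coe_lt_top).ne
  have hκm₀ : 0 < κ m₀ := hκ.pos _ ⟨hm₀, (toReal_min_mem_Icc hl.le _).2⟩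
  have hhalf : ((c / 2 : ℝ≥0) : ENNReal) ≤ c := by
    rw [ENNReal.coe_le_coe, ← NNReal.coe_le_coe]
    push_cast
    linarith [c.coe_nonneg]
  refine ⟨_, hcV, D + 2 * M / κ m₀, by positivity, fun x hx y => ?_⟩
  have hmem := toReal_min_mem_Icc hl.le (g.geodesicEDist x y)
  have hnn := hκ.nonneg hmem
  rcases lt_or_ge (g.geodesicEDist x y) (c / 2 : ℝ≥0) with h | h
  · have hy : g.geodesicEDist x₀ y < c := by
      calc g.geodesicEDist x₀ y ≤ g.geodesicEDist x₀ x + g.geodesicEDist x y := htri x y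
        _ < (c / 2 : ℝ≥0) + (c / 2 : ℝ≥0) := ENNReal.add_lt_add hx h
        _ = c := by rw [← ENNReal.coe_add, add_halves]
    refine (hmod x (hcW (lt_of_lt_of_le hx hhalf)) y (hcW hy)).trans ?_
    refine mul_le_mul_of_nonneg_right ?_ hnn
    have : 0 ≤ 2 * M / κ m₀ := by positivity
    linarith
  · have h1 : m₀ ≤ (min (g.geodesicEDist x y) (ENNReal.ofReal l)).toReal :=
      ENNReal.toReal_mono (min_lt_of_right_lt ENNReal.ofReal_lt_top).ne (min_le_min_right _ h)
    have h2 := hκ.monotoneOn (toReal_min_mem_Icc hl.le _) hmem h1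
    have h3 : |φ x - φ y| ≤ 2 * M := by
      have := abs_sub (φ x) (φ y)
      linarith [hM x, hM y]
    calc |φ x - φ y| ≤ 2 * M / κ m₀ * κ m₀ := by rwa [div_mul_cancel₀ _ hκm₀.ne']
      _ ≤ (D + 2 * M / κ m₀) * κ (min (g.geodesicEDist x y) (ENNReal.ofReal l)).toReal := by
          refine mul_le_mul ?_ h2 hκm₀.le (by positivity)
          linarith

end Manifold

theorem mainTheorem3 {n : ℕ} {X : Type*} [TopologicalSpace X] [T2Space X] [CompactSpace X]
    [ChartedSpace (Cn n) X] [IsManifold 𝓘(ℂ, Cn n) ω X] (g : HermitianMetric n X)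
    (l : ℝ) (κ : ℝ → ℝ) (hκ : IsModulusOfContinuity l κ) (hgrowth : GrowthCondition n κ)
    (ρ : Cn n → ℝ) (hρ : IsRadialKernel ρ)
    (φ : X → ℝ) (hbdd : ∃ M : ℝ, ∀ x, |φ x| ≤ M) (hφ : g.IsPlurisubharmonic φ)
    (hreg : LocalRegularizationBound l κ ρ φ) :
    ∃ C₂ : ℝ, 0 < C₂ ∧ ∀ x y : X,
      |φ x - φ y| ≤ C₂ * κ (min (g.geodesicEDist x y) (ENNReal.ofReal l)).toReal := by
  obtain ⟨M, hM⟩ := hbdd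
  have h : ∃ D : ℝ, 0 < D ∧ ∀ x ∈ (univ : Set X), ∀ y,
      |φ x - φ y| ≤ D * κ (min (g.geodesicEDist x y) (ENNReal.ofReal l)).toReal := by
    -- Only `x` is restricted to `s`, while `y` ranges over all of `X`; this is what makes the
    -- property stable under unions.
    refine isCompact_univ.induction_on (p := fun s => ∃ D : ℝ, 0 < D ∧ ∀ x ∈ s, ∀ y,
      |φ x - φ y| ≤ D * κ (min (g.geodesicEDist x y) (ENNReal.ofReal l)).toReal)
      ⟨1, one_pos, by simp⟩ ?_ ?_ ?_
    · rintro s t hst ⟨D, hD, h⟩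
      exact ⟨D, hD, fun x hx => h x (hst hx)⟩
    · rintro s t ⟨D, hD, h⟩ ⟨D', hD', h'⟩
      refine ⟨max D D', lt_max_of_lt_left hD, fun x hx y => ?_⟩
      have hnn := hκ.nonneg (toReal_min_mem_Icc hκ.length_pos.le (g.geodesicEDist x y))
      rcases hx with hx | hx
      · exact (h x hx y).trans (mul_le_mul_of_nonneg_right (le_max_left _ _) hnn)
      · exact (h' x hx y).trans (mul_le_mul_of_nonneg_right (le_max_right _ _) hnn)
    · intro x₀ _
      obtain ⟨V, hV, hD⟩ := exists_semilocal_geodesic_modulus hκ hgrowth hρ hM hφ hreg x₀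
      exact ⟨V, mem_nhdsWithin_of_mem_nhds hV, hD⟩
  obtain ⟨D, hD, h⟩ := h
  exact ⟨D, hD, fun x y => h x (mem_univ x) y⟩
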